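/- Corollary (585-competitive algorithm for SMSP over laminar matroids). An instance of the submodular matroid secretary problem (SMSP) consists of a finite ground set $E$, a matroid $\mathcal M=(E,\mathcal I)$ and a non-negative submodular function $f\colon 2^E\to\mathbb R_{\ge 0}$, i.e. $f(A\cup\{e\})-f(A)\ge f(B\cup\{e\})-f(B)$ for all $A\subseteq B\subseteq E$ and $e\in E\setminus B$. The elements of $E$ arrive in a uniformly random order. A (randomized) online algorithm knows $n=|E|$ in advance, and has access to a value oracle returning $f(S)$ and to an independence oracle deciding whether $S\in\mathcal I$, both only for sets $S$ of elements that have already arrived; it must accept or reject each element immediately and irrevocably upon arrival. A matroid $\mathcal M=(E,\mathcal I)$ is laminar if there are a family $\mathcal F$ of subsets of $E$, any two of which are nested or disjoint, and capacities $c\colon\mathcal F\to\mathbb Z_{\ge 0}$ such that $\mathcal I=\{I\subseteq E : |I\cap A|\le c(A)\text{ for all }A\in\mathcal F\}$. There exists a single online algorithm such that, for every SMSP instance $(E,\mathcal M,f)$ with $\mathcal M$ laminar, the set $Q$ that it accepts is always independent in $\mathcal M$, and $$\mathbb E[f(Q)]\ \ge\ \frac{1}{585}\,\max_{S\in\mathcal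 I} f(S),$$ where the expectation is over the random arrival order and the internal randomness of the algorithm. -/

import Mathlib

universe u

namespace SMSP

/-- A set function on the subsets of `E` is submodular if it has diminishing returns. -/
def IsSubmodular {E : Type u} [DecidableEq E] (f : Finset E → ℝ) : Prop :=
  ∀ ⦃A B : Finset E⦄, A ⊆ B → ∀ e ∉ B, f (insert e B) - f B ≤ f (insert e A) - f A

/-- A family of sets is laminar if any two members are nested or disjoint. -/
def IsLaminarFamily {E : Type u} (F : Set (Set E)) : Prop :=
  ∀ A ∈ F, ∀ B ∈ F, A ⊆ B ∨ B ⊆ A ∨ Disjoint A B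

/-- A laminar matroid: there are a laminar family `F` of subsets of the ground set and capacities
`c : F → ℕ` such that the independent sets are exactly the sets that contain at most `c A` elements
of each member `A` of `F`. -/
def IsLaminarMatroid {E : Type u} (M : Matroid E) : Prop :=
  ∃ (F : Set (Set E)) (c : Set E → ℕ),
    (∀ A ∈ F, A ⊆ M.E) ∧ IsLaminarFamily F ∧
      ∀ I ⊆ M.E, (M.Indep I ↔ ∀ A ∈ F, (I ∩ A).encard ≤ (c A : ℕ∞))

/-- The optimum offline value `f(OPT)`: the maximum of `f` over the independent sets of `M`. -/
noncomputable def optValue {E : Type u} [Fintype E] (M : Matroid E) (f : Finset E → ℝ) : ℝ := by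
  classical
  exact (Finset.univ.filter fun S : Finset E => M.Indep (S : Set E)).sup'
    ⟨∅, by simp⟩ f

/-- A randomized online algorithm for the secretary problem.

The algorithm knows the number `n` of elements. Before the first arrival it draws a random seed
from a distribution that may depend on `n` only. The elements are anonymous: the algorithm refers
to them by their times of arrival `0, 1, …, n - 1`. When the element of time `t` arrives, the
algorithm has access to a value oracle and to an independence oracle for the sets of elements that
arrived at the times `0, …, t`, and it decides immediately and irrevocably whether the element is
accepted. (Earlier answers of the oracles and earlier decisions are determined by the same data.) -/
structure OnlineAlgorithm where
  /-- the possible values of the random seed -/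
  Seed : ℕ → Type
  /-- there are finitely many seeds -/
  [seedFintype : ∀ n, Fintype (Seed n)]
  /-- the distribution of the random seed -/
  dist : ∀ n, PMF (Seed n)
  /-- `accept n ω t value indep` is `true` if the element of time `t` is accepted -/
  accept : (n : ℕ) → Seed n → (t : Fin n) →
    (value : Finset (Fin (t + 1)) → ℝ) → (indep : Finset (Fin (t + 1)) → Prop) → Bool

attribute [instance] OnlineAlgorithm.seedFintype

section Run

variable {E : Type u} [Fintype E]

/-- For an arrival order `π`, the embedding of the times `0, …, t` into the ground set: time `s` is
sent to the element that arrives at time `s`. -/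
def arrived (π : Fin (Fintype.card E) ≃ E) (t : Fin (Fintype.card E)) : Fin (t + 1) ↪ E :=
  (Fin.castLEEmb (Nat.succ_le_of_lt t.isLt)).trans π.toEmbedding

/-- The set of elements that the algorithm accepts on the matroid `M` and the objective `f`, when
the elements arrive in the order `π` and the random seed is `ω`. -/
def OnlineAlgorithm.output (A : OnlineAlgorithm) (M : Matroid E) (f : Finset E → ℝ)
    (π : Fin (Fintype.card E) ≃ E) (ω : A.Seed (Fintype.card E)) : Finset E :=
  (Finset.univ.filter fun t : Fin (Fintype.card E) =>
    A.accept (Fintype.card E) ω t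
      (fun S => f (S.map (arrived π t)))
      (fun S => M.Indep (S.map (arrived π t) : Set E)) = true).map π.toEmbedding

/-- The expected value of the accepted set, over a uniformly random arrival order and an independent
random seed. -/
noncomputable def OnlineAlgorithm.expectedValue [DecidableEq E] (A : OnlineAlgorithm)
    (M : Matroid E) (f : Finset E → ℝ) : ℝ :=
  (∑ π : Fin (Fintype.card E) ≃ E, ∑ ω : A.Seed (Fintype.card E),
    (A.dist (Fintype.card E) ω).toReal * f (A.output M f π ω)) / (Fintype.card E).factorial

end Run

/-- The algorithm is `α`-competitive for the submodular matroid secretary problem over the matroids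
with the property `P`: for each such matroid on a finite ground set `E` and each non-negative
submodular objective, the accepted set is always independent and its expected value is at least
`1 / α` times the offline optimum. -/
def OnlineAlgorithm.IsCompetitiveOn (A : OnlineAlgorithm) (α : ℝ)
    (P : ∀ {E : Type u}, Matroid E → Prop) : Prop :=
  ∀ (E : Type u) [Fintype E] [DecidableEq E] (M : Matroid E) (f : Finset E → ℝ),
    M.E = Set.univ → P M → (∀ S, 0 ≤ f S) → IsSubmodular f →
      (∀ π ω, M.Indep (A.output M f π ω : Set E)) ∧
        (1 / α) * optValue M f ≤ A.expectedValue M f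

end SMSP

/-! The algorithm rejects an initial stretch of binomial length, the sample, and marks each later
element with probability 1/50. The analysis follows a greedy run over all elements: it processes the
unprocessed element of largest positive gain over the sampled elements processed so far, among those
that keep this set independent. The coin of an element matters only once it is processed, so it is
independent of the history (`sum_step_mul`). Unsampled elements do not influence the others, so the
sample and an element alone determine whether that element is processed (`processed_univ_inter`).
The marked processed elements are the candidates. A candidate is accepted if it extends every
independent set of earlier candidates; so the accepted set is independent, and a candidate that lies
in no overfull member of the laminar family is accepted.

Let W be the expected total gain of the processed elements, and O an optimal set. The sampled
processed elements have expected value g ∅ + W/2. Matroid exchange (`union_chosen_le`) and the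
sampling lemma for submodular functions (`IsSubmodular.sum_random_set`) give W ≥ (g O - 2 g ∅)/3.
The candidates, valued on top of all earlier sampled and marked processed elements, contribute at
least (49/100 W - g ∅/50)/51 in expectation.

It remains to bound the loss from overfull sets. Let A have capacity k and contain x > k candidates.
Gains decrease along the run, so these candidates lose at most x times the first gain in A. With y
the number of sampled processed elements of A, 26^x / 2^y is a martingale, and y ≤ k because the
sampled processed elements are independent. This exponential moment bounds the expected loss in A by
2 (2^k - 1) / (45 · 15^k) times the expected first gain in A. For each k only the maximal members of
capacity k matter; they are disjoint, so their first gains sum to at most W, and summing over k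
gives a loss of at most W/273. -/

namespace SMSP

open Finset

/-! ### The greedy run and its dependence on the sample -/

section Greedy

variable {α : Type u} [Fintype α] [LinearOrder α]

/-- The gain of `g` from adding `e` to `S`. -/
def marginal (g : Finset α → ℝ) (S : Finset α) (e : α) : ℝ := g (insert e S) - g S

/-- `e` may be processed next: it belongs to `X`, is not yet processed, and extends the processed
elements of `L` to an independent set of larger value. -/
def IsCandidate (g : Finset α → ℝ) (I : Finset α → Prop) (X L P : Finset α) (e : α) : Prop :=
  e ∈ X ∧ e ∉ P ∧ I (insert e (P ∩ L)) ∧ 0 < marginal g (P ∩ L) e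

/-- `e` is the candidate with the largest gain, the smallest one in case of ties. -/
def IsNext (g : Finset α → ℝ) (I : Finset α → Prop) (X L P : Finset α) (e : α) : Prop :=
  IsCandidate g I X L P e ∧ ∀ v, IsCandidate g I X L P v →
    marginal g (P ∩ L) v < marginal g (P ∩ L) e ∨
      (marginal g (P ∩ L) v = marginal g (P ∩ L) e ∧ e ≤ v)

open scoped Classical in
/-- The set of the element that is processed next (empty if there are no candidates). -/
noncomputable def next (g : Finset α → ℝ) (I : Finset α → Prop) (X L P : Finset α) : Finset α :=
  univ.filter (IsNext g I X L P)

/-- The elements of `X` that are processed in the first `i` steps by the greedy algorithm that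
keeps exactly the processed elements of `L`. -/
noncomputable def processed (g : Finset α → ℝ) (I : Finset α → Prop) (X L : Finset α) :
    ℕ → Finset α
  | 0 => ∅
  | i + 1 => processed g I X L i ∪ next g I X L (processed g I X L i)

variable {g : Finset α → ℝ} {I : Finset α → Prop} {X L P : Finset α} {e v : α}

omit [Fintype α] in
lemma IsSubmodular.marginal_le (hg : IsSubmodular g) {A B : Finset α} (h : A ⊆ B) (he : e ∉ B) :
    marginal g B e ≤ marginal g A e := hg h e he

lemma mem_next : e ∈ next g I X L P ↔ IsNext g I X L P e := by simp [next]

omit [Fintype α] in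
lemma IsNext.marginal_le (h : IsNext g I X L P e) (hv : IsCandidate g I X L P v) :
    marginal g (P ∩ L) v ≤ marginal g (P ∩ L) e := by
  rcases h.2 v hv with h | h
  · exact h.le
  · exact h.1.le

omit [Fintype α] in
lemma IsNext.unique (he : IsNext g I X L P e) (hv : IsNext g I X L P v) : e = v := by
  rcases he.2 v hv.1 with h | h <;> rcases hv.2 e he.1 with h' | h'
  · linarith
  · linarith [h'.1]
  · linarith [h.1]
  · exact le_antisymm h.2 h'.2

lemma next_eq_singleton (he : IsNext g I X L P e) : next g I X L P = {e} := by
  ext v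
  rw [mem_next, mem_singleton]
  exact ⟨fun h => h.unique he, fun h => h ▸ he⟩

lemma exists_isNext (hv : IsCandidate g I X L P v) : ∃ e, IsNext g I X L P e := by
  classical
  obtain ⟨e, he, hmax⟩ := (univ.filter (IsCandidate g I X L P)).exists_max_image
    (fun e => toLex (marginal g (P ∩ L) e, OrderDual.toDual e)) ⟨v, by simpa using hv⟩
  refine ⟨e, by simpa using he, fun w hw => ?_⟩
  have := hmax w (by simpa using hw)
  rw [Prod.Lex.toLex_le_toLex] at this
  simpa using this

lemma next_eq_empty_iff : next g I X L P = ∅ ↔ ∀ e, ¬ IsCandidate g I X L P e := by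
  constructor
  · intro h v hv
    obtain ⟨e, he⟩ := exists_isNext hv
    simpa [h] using mem_next.2 he
  · intro h
    ext e
    simpa [mem_next] using fun he : IsNext g I X L P e => h e he.1

lemma processed_succ_cases (g : Finset α → ℝ) (I : Finset α → Prop) (X L : Finset α) (i : ℕ) :
    (next g I X L (processed g I X L i) = ∅ ∧
        processed g I X L (i + 1) = processed g I X L i) ∨
      ∃ e, IsNext g I X L (processed g I X L i) e ∧
        next g I X L (processed g I X L i) = {e} ∧
        processed g I X L (i + 1) = insert e (processed g I X L i) := by
  rcases (next g I X L (processed g I X L i)).eq_empty_or_nonempty with h | ⟨e, he⟩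
  · left
    simp [processed, h]
  · right
    rw [mem_next] at he
    refine ⟨e, he, next_eq_singleton he, ?_⟩
    rw [processed, next_eq_singleton he]
    ext
    simp

lemma processed_mono : Monotone (processed g I X L) :=
  monotone_nat_of_le_succ fun _ => subset_union_left

lemma processed_subset (i : ℕ) : processed g I X L i ⊆ X := by
  induction i with
  | zero => simp [processed]
  | succ i ih =>
    rcases processed_succ_cases g I X L i with h | ⟨e, h, -, h'⟩
    · rwa [h.2]
    · rw [h']
      exact insert_subset h.1.1 ih

lemma indep_processed (h0 : I ∅) (hI : ∀ A B, A ⊆ B → I B → I A) (i : ℕ) :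
    I (processed g I X L i ∩ L) := by
  induction i with
  | zero => simpa [processed] using h0
  | succ i ih =>
    rcases processed_succ_cases g I X L i with h | ⟨e, h, -, h'⟩
    · rwa [h.2]
    · rw [h']
      refine hI _ _ ?_ h.1.2.2.1
      intro x
      simp only [mem_inter, mem_insert]
      tauto

/-- After as many steps as there are elements, no candidates are left. -/
lemma not_isCandidate_processed_card (e : α) :
    ¬ IsCandidate g I X L (processed g I X L (Fintype.card α)) e := by
  -- Until the run gets stuck, every step processes a new element.
  have key : ∀ i, next g I X L (processed g I X L i) = ∅ ∨ (processed g I X L i).card = i := by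
    intro i
    induction i with
    | zero => simp [processed]
    | succ i ih =>
      rcases processed_succ_cases g I X L i with h | ⟨e, h, h1, h'⟩
      · left
        rw [h.2, h.1]
      · right
        rw [h', card_insert_of_notMem h.1.2.1, ih.resolve_left (by simp [h1])]
  rcases key (Fintype.card α) with h | h
  · exact next_eq_empty_iff.1 h e
  · rw [(Finset.card_eq_iff_eq_univ _).1 h]
    exact fun h => h.2.1 (mem_univ _)

lemma processed_congr {g' : Finset α → ℝ} {I' : Finset α → Prop} (hg : ∀ S ⊆ X, g S = g' S)
    (hI : ∀ S ⊆ X, (I S ↔ I' S)) (i : ℕ) : processed g I X L i = processed g' I' X L i := by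
  induction i with
  | zero => rfl
  | succ i ih =>
    have hP := processed_subset (g := g) (I := I) (X := X) (L := L) i
    rw [processed, processed, ← ih]
    set P := processed g I X L i
    have hPL : P ∩ L ⊆ X := inter_subset_left.trans hP
    have hm : ∀ e ∈ X, marginal g (P ∩ L) e = marginal g' (P ∩ L) e := fun e he => by
      rw [marginal, marginal, hg _ hPL, hg _ (insert_subset he hPL)]
    have hc : ∀ e, IsCandidate g I X L P e ↔ IsCandidate g' I' X L P e := fun e => by
      refine and_congr_right fun he => ?_
      rw [hm e he, hI _ (insert_subset he hPL)]
    congr 1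
    ext e
    rw [mem_next, mem_next, IsNext, IsNext, hc]
    refine and_congr_right fun he => forall_congr' fun v => ?_
    rw [hc]
    refine imp_congr_right fun hv => ?_
    rw [hm e he.1, hm v hv.1]

/-- Steps of the elements outside `L` do not influence the other elements. -/
lemma processed_univ_inter (hLX : L ⊆ X) :
    processed g I univ L (Fintype.card α) ∩ X = processed g I X L (Fintype.card α) := by
  have hPL : ∀ P : Finset α, P ∩ X ∩ L = P ∩ L := fun P => by
    rw [inter_assoc, inter_eq_right.2 hLX]
  have hc : ∀ (P : Finset α) e, IsCandidate g I X L (P ∩ X) e ↔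
      IsCandidate g I univ L P e ∧ e ∈ X := fun P e => by
    simp only [IsCandidate, hPL, mem_inter, mem_univ, true_and]
    tauto
  -- The run on `X` is the full run with the steps outside `X` deleted: since `L ⊆ X`, such steps
  -- leave `P ∩ L` unchanged.
  have key : ∀ i, ∃ j ≤ i, processed g I univ L i ∩ X = processed g I X L j := by
    intro i
    induction i with
    | zero => exact ⟨0, le_rfl, by simp [processed]⟩
    | succ i ih =>
      obtain ⟨j, hj, hP⟩ := ih
      rcases processed_succ_cases g I univ L i with h | ⟨e, h, -, h'⟩
      · exact ⟨j, by omega, by rw [h.2, hP]⟩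
      · by_cases he : e ∈ X
        · refine ⟨j + 1, by omega, ?_⟩
          have hn : IsNext g I X L (processed g I X L j) e := by
            rw [← hP]
            refine ⟨(hc _ _).2 ⟨h.1, he⟩, fun v hv => ?_⟩
            rw [hPL]
            exact h.2 v ((hc _ _).1 hv).1
          rw [h', processed, next_eq_singleton hn, ← hP, insert_inter_of_mem he, insert_eq,
            union_comm]
        · exact ⟨j, by omega, by rw [h', insert_inter_of_notMem he, hP]⟩
  obtain ⟨j, hj, hP⟩ := key (Fintype.card α)
  rw [hP]
  have hstuck : ∀ m, processed g I X L (j + m) = processed g I X L j := by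
    intro m
    induction m with
    | zero => rfl
    | succ m ih =>
      rw [← add_assoc, processed, ih, next_eq_empty_iff.2, union_empty]
      intro e he
      rw [← hP, hc] at he
      exact not_isCandidate_processed_card e he.1
  rw [← hstuck (Fintype.card α - j), Nat.add_sub_cancel' hj]

/-- The history before an element is processed does not depend on whether it belongs to `L`. -/
lemma processed_eq_of_notMem {L' : Finset α} (hL : ∀ x ≠ e, x ∈ L ↔ x ∈ L') (i : ℕ)
    (he : e ∉ processed g I X L i) : processed g I X L' i = processed g I X L i := by
  induction i with
  | zero => rfl
  | succ i ih =>
    have he' : e ∉ processed g I X L i := fun h => he (processed_mono (Nat.le_succ i) h)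
    rw [processed, processed, ih he']
    have hPL : processed g I X L i ∩ L' = processed g I X L i ∩ L := by
      ext x
      simp only [mem_inter]
      refine and_congr_right fun hx => (hL x ?_).symm
      rintro rfl
      exact he' hx
    congr 1
    ext x
    simp only [mem_next, IsNext, IsCandidate, hPL]

lemma next_eq_of_notMem {L' : Finset α} (hL : ∀ x ≠ e, x ∈ L ↔ x ∈ L')
    (he : e ∉ P) : next g I X L' P = next g I X L P := by
  have hPL : P ∩ L' = P ∩ L := by
    ext x
    simp only [mem_inter]
    refine and_congr_right fun hx => (hL x ?_).symm
    rintro rfl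
    exact he hx
  ext x
  simp only [mem_next, IsNext, IsCandidate, hPL]

/-- The gains of the processed elements decrease. -/
lemma marginal_anti (hg : IsSubmodular g) (hI : ∀ A B, A ⊆ B → I B → I A) {i j : ℕ} (hij : i ≤ j)
    (he : IsNext g I X L (processed g I X L i) e) (hv : IsNext g I X L (processed g I X L j) v) :
    marginal g (processed g I X L j ∩ L) v ≤ marginal g (processed g I X L i ∩ L) e := by
  have hsub : processed g I X L i ∩ L ⊆ processed g I X L j ∩ L :=
    inter_subset_inter_right (processed_mono hij)
  have hm := hg.marginal_le hsub (e := v) fun h => hv.1.2.1 (mem_inter.1 h).1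
  refine hm.trans (he.marginal_le ⟨hv.1.1, fun h => hv.1.2.1 (processed_mono hij h),
    hI _ _ (insert_subset_insert _ hsub) hv.1.2.2.1, hv.1.2.2.2.trans_le hm⟩)

end Greedy

/-! ### Resampling a coin; submodular functions of random sets -/

section Averaging

variable {α : Type u} [Fintype α] [DecidableEq α] {β : Type*} [Fintype β]

/-- Resampling one coordinate. -/
lemma card_mul_sum_mul_apply (e : α) (F : (α → β) → ℝ)
    (hF : ∀ c a, F (Function.update c e a) = F c) (r : β → ℝ) :
    Fintype.card β * ∑ c, F c * r (c e) = (∑ a, r a) * ∑ c, F c := by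
  -- Swapping the coordinate at `e` with a fresh one is an involution that preserves `F`.
  have h1 : ∑ x : (α → β) × β, F x.1 * r (x.1 e) = ∑ x : (α → β) × β, F x.1 * r x.2 := by
    have hinv : Function.Involutive
        fun x : (α → β) × β => (Function.update x.1 e x.2, x.1 e) :=
      fun x => Prod.ext (by simp) (by simp)
    refine Fintype.sum_equiv hinv.toPerm _ _ fun x => ?_
    simp only [Function.Involutive.coe_toPerm, hF]
  rw [Fintype.sum_prod_type, Fintype.sum_prod_type] at h1
  simp only [sum_const, card_univ, nsmul_eq_mul] at h1
  rw [mul_sum, h1, mul_comm, sum_mul]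
  exact sum_congr rfl fun c _ => (mul_sum _ _ _).symm

/-- If a random set contains each element with probability at most `q`, then a nonnegative
submodular function loses in expectation at most the fraction `q` of its value at `∅`. -/
lemma IsSubmodular.sum_random_set {ι : Type*} [Fintype ι] {h : Finset α → ℝ}
    (hh : IsSubmodular h) (h0 : ∀ S, 0 ≤ h S) (A : ι → Finset α) {q : ℝ} (hq : 0 ≤ q)
    (hA : ∀ e, (∑ ω, if e ∈ A ω then (1 : ℝ) else 0) ≤ q * Fintype.card ι) :
    (1 - q) * Fintype.card ι * h ∅ ≤ ∑ ω, h (A ω) := by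
  set x : α → ℝ := fun e => ∑ ω, if e ∈ A ω then (1 : ℝ) else 0 with hx
  -- Elements are added in order of decreasing probability; the running weight `y` performs an Abel
  -- summation, and nonnegativity of `h` allows it to be lowered.
  have key : ∀ S : Finset α, ∀ y ≤ q * Fintype.card ι, (∀ e ∈ S, y ≤ x e) →
      (1 - q) * Fintype.card ι * h ∅ + y * h S ≤ ∑ ω, h (A ω ∩ S) := by
    intro S
    induction S using Finset.induction_on_min_value x with
    | empty =>
      intro y hy _
      simp only [inter_empty, sum_const, card_univ, nsmul_eq_mul]
      nlinarith [h0 ∅]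
    | insert a s ha hmin ih =>
      intro y _ hyx
      have h1 := ih (x a) (hA a) hmin
      have h2 : ∑ ω, h (A ω ∩ s) + x a * (h (insert a s) - h s) ≤ ∑ ω, h (A ω ∩ insert a s) := by
        rw [hx, sum_mul, ← sum_add_distrib]
        refine sum_le_sum fun ω _ => ?_
        by_cases haω : a ∈ A ω
        · have := hh (inter_subset_right (s₁ := A ω) (s₂ := s)) a ha
          rw [inter_insert_of_mem haω]
          simp only [haω, if_true]
          linarith
        · rw [inter_insert_of_notMem haω]
          simp [haω]
      have h3 := mul_le_mul_of_nonneg_right (hyx a (mem_insert_self _ _)) (h0 (insert a s))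
      linarith
  have := key univ 0 (by positivity) fun e _ => sum_nonneg fun ω _ => by split_ifs <;> simp
  simpa using this

end Averaging

/-! ### Inequalities for a fixed sample -/

section Pathwise

variable {α : Type u} [Fintype α] [LinearOrder α]

lemma sum_next_sub (g : Finset α → ℝ) (I : Finset α → Prop) (X L : Finset α) (Φ : Finset α → ℝ)
    (m : ℕ) :
    ∑ i ∈ range m, ∑ e ∈ next g I X L (processed g I X L i),
      (Φ (insert e (processed g I X L i)) - Φ (processed g I X L i)) =
    Φ (processed g I X L m) - Φ ∅ := by
  have : Φ ∅ = Φ (processed g I X L 0) := rfl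
  rw [this, ← sum_range_sub (fun i => Φ (processed g I X L i))]
  refine sum_congr rfl fun i _ => ?_
  rcases processed_succ_cases g I X L i with h | ⟨e, -, h1, h'⟩
  · simp [h.1, h.2]
  · rw [h1, sum_singleton, h']

lemma sum_next_marginal (g : Finset α → ℝ) (I : Finset α → Prop) (X L S : Finset α) (m : ℕ) :
    ∑ i ∈ range m, ∑ e ∈ next g I X L (processed g I X L i),
      (if e ∈ S then marginal g (processed g I X L i ∩ S) e else 0) =
    g (processed g I X L m ∩ S) - g ∅ := by
  have := sum_next_sub g I X L (fun P => g (P ∩ S)) m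
  rw [empty_inter] at this
  rw [← this]
  refine sum_congr rfl fun i _ => sum_congr rfl fun e _ => ?_
  split_ifs with h
  · rw [insert_inter_of_mem h, marginal]
  · rw [insert_inter_of_notMem h, sub_self]

/-- The total gain of the processed elements at the times at which they are processed. -/
noncomputable def totalGain (g : Finset α → ℝ) (I : Finset α → Prop) (L : Finset α) : ℝ :=
  ∑ i ∈ range (Fintype.card α), ∑ e ∈ next g I univ L (processed g I univ L i),
    marginal g (processed g I univ L i ∩ L) e

variable {g : Finset α → ℝ} {I : Finset α → Prop} {X L P : Finset α} {e v : α}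

omit [Fintype α] in
lemma IsSubmodular.union_le (hg : IsSubmodular g) (M T : Finset α) (h : Disjoint T M) :
    g (T ∪ M) ≤ g M + ∑ o ∈ T, marginal g M o := by
  induction T using Finset.induction_on with
  | empty => simp
  | insert a s ha ih =>
    rw [disjoint_insert_left] at h
    have h1 := hg.marginal_le (A := M) (B := s ∪ M) (e := a) subset_union_right
      (by simp [ha, h.1])
    rw [marginal] at h1
    rw [insert_union, sum_insert ha]
    linarith [ih h.2]

lemma marginal_nonneg_of_mem_next (h : e ∈ next g I X L P) : 0 ≤ marginal g (P ∩ L) e :=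
  (mem_next.1 h).1.2.2.2.le

/-- Greedy analysis: every processed element rules out at most one element of an independent
set. -/
lemma union_chosen_le (hg : IsSubmodular g) (hI : ∀ A B, A ⊆ B → I B → I A)
    (hex : ∀ A J e, I (A ∪ J) → I (insert e A) →
      ∃ J' ⊆ J, (J \ J').card ≤ 1 ∧ I (insert e A ∪ J')) (L O : Finset α) (hO : I O) :
    g (O ∪ processed g I univ L (Fintype.card α) ∩ L) ≤
      g (processed g I univ L (Fintype.card α) ∩ L) + totalGain g I L := by
  -- `J` is the part of `O` that is still addable. An element leaving `J` was a possible choice, so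
  -- its positive gain is at most that of the element then processed.
  have key : ∀ i, ∃ J ⊆ O, Disjoint J (processed g I univ L i) ∧
      I (processed g I univ L i ∩ L ∪ J) ∧
      ∑ o ∈ (O \ J) \ (processed g I univ L i ∩ L),
        max 0 (marginal g (processed g I univ L i ∩ L) o) ≤
      ∑ j ∈ range i, ∑ e ∈ next g I univ L (processed g I univ L j),
        marginal g (processed g I univ L j ∩ L) e := by
    intro i
    induction i with
    | zero => exact ⟨O, Subset.rfl, by simp [processed], by simpa [processed] using hO, by simp⟩
    | succ i ih =>
      obtain ⟨J, hJO, hJP, hJ, hsum⟩ := ih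
      rcases processed_succ_cases g I univ L i with h | ⟨e, h, h1, h'⟩
      · refine ⟨J, hJO, by rwa [h.2], by rwa [h.2], ?_⟩
        rw [h.2, sum_range_succ, h.1, sum_empty, add_zero]
        exact hsum
      · rw [h', sum_range_succ, h1, sum_singleton]
        set P := processed g I univ L i
        have hw : 0 < marginal g (P ∩ L) e := h.1.2.2.2
        -- An element of `J` rules out only itself, a sampled one at most one other element by
        -- exchange, and an unsampled one nothing.
        obtain ⟨J', hJ'J, heJ', hJ', hcard⟩ : ∃ J' ⊆ J, e ∉ J' ∧ I (insert e P ∩ L ∪ J') ∧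
            ((J \ J') \ (insert e P ∩ L)).card ≤ 1 := by
          by_cases heJ : e ∈ J
          · refine ⟨J.erase e, erase_subset _ _, notMem_erase _ _, hI _ _ ?_ hJ, ?_⟩
            · intro x
              simp only [mem_union, mem_inter, mem_insert, mem_erase]
              rintro (⟨rfl | h, h'⟩ | h)
              · exact Or.inr heJ
              · exact Or.inl ⟨h, h'⟩
              · exact Or.inr h.2
            · refine (card_le_card (sdiff_subset.trans ?_)).trans (card_singleton e).le
              intro x
              simp only [mem_sdiff, mem_erase, mem_singleton]
              tauto
          · by_cases heL : e ∈ L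
            · obtain ⟨J', hJ'J, hc, hJ'⟩ := hex _ _ _ hJ h.1.2.2.1
              refine ⟨J', hJ'J, fun h => heJ (hJ'J h), ?_, (card_le_card sdiff_subset).trans hc⟩
              rwa [insert_inter_of_mem heL]
            · refine ⟨J, Subset.rfl, heJ, ?_, by simp⟩
              rwa [insert_inter_of_notMem heL]
        refine ⟨J', hJ'J.trans hJO, ?_, hJ', ?_⟩
        · rw [disjoint_insert_right]
          exact ⟨heJ', hJP.mono_left hJ'J⟩
        · have hM : P ∩ L ⊆ insert e P ∩ L := inter_subset_inter_right (subset_insert _ _)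
          have hterm : ∀ o ∉ insert e P ∩ L, max 0 (marginal g (insert e P ∩ L) o) ≤
              max 0 (marginal g (P ∩ L) o) :=
            fun o ho => max_le_max le_rfl (hg.marginal_le hM ho)
          have hsub : (O \ J') \ (insert e P ∩ L) ⊆
              ((O \ J) \ (P ∩ L)) ∪ ((J \ J') \ (insert e P ∩ L)) := by
            intro x hx
            have := @hM x
            simp only [mem_sdiff, mem_union] at hx ⊢
            tauto
          calc ∑ o ∈ (O \ J') \ (insert e P ∩ L), max 0 (marginal g (insert e P ∩ L) o)
              ≤ ∑ o ∈ (O \ J') \ (insert e P ∩ L), max 0 (marginal g (P ∩ L) o) :=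
                sum_le_sum fun o ho => hterm o (mem_sdiff.1 ho).2
            _ ≤ ∑ o ∈ ((O \ J) \ (P ∩ L)) ∪ ((J \ J') \ (insert e P ∩ L)),
                  max 0 (marginal g (P ∩ L) o) :=
                sum_le_sum_of_subset_of_nonneg hsub fun _ _ _ => le_max_left _ _
            _ ≤ ∑ o ∈ (O \ J) \ (P ∩ L), max 0 (marginal g (P ∩ L) o) +
                  ∑ o ∈ (J \ J') \ (insert e P ∩ L), max 0 (marginal g (P ∩ L) o) := by
                rw [← sum_union_inter]
                exact le_add_of_nonneg_right (sum_nonneg fun _ _ => le_max_left _ _)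
            _ ≤ _ := by
                refine add_le_add hsum ?_
                refine (sum_le_card_nsmul _ _ (marginal g (P ∩ L) e) fun o ho => ?_).trans ?_
                · refine max_le hw.le ?_
                  by_contra! hlt
                  have hoJ : o ∈ J := (mem_sdiff.1 (mem_sdiff.1 ho).1).1
                  refine absurd (h.marginal_le (v := o) ⟨mem_univ _, ?_, ?_, hw.trans hlt⟩)
                    hlt.not_ge
                  · exact disjoint_left.1 hJP hoJ
                  · refine hI _ _ ?_ hJ
                    exact insert_subset (mem_union_right _ hoJ) subset_union_left
                · rw [nsmul_eq_mul]
                  have : (((J \ J') \ (insert e P ∩ L)).card : ℝ) ≤ 1 := by exact_mod_cast hcard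
                  nlinarith
  obtain ⟨J, -, hJP, hJ, hsum⟩ := key (Fintype.card α)
  set P := processed g I univ L (Fintype.card α) with hP
  have h1 := hg.union_le (P ∩ L) (O \ (P ∩ L)) sdiff_disjoint
  rw [sdiff_union_self_eq_union] at h1
  refine h1.trans (add_le_add le_rfl (le_trans ?_ hsum))
  rw [sdiff_right_comm, ← sum_inter_add_sum_sdiff (O \ (P ∩ L)) J]
  -- What survives in `J` could still be added, so only a nonpositive gain keeps it from being a
  -- candidate.
  have h2 : ∑ o ∈ (O \ (P ∩ L)) ∩ J, marginal g (P ∩ L) o ≤ 0 := by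
    refine sum_nonpos fun o ho => ?_
    rw [mem_inter] at ho
    by_contra! hlt
    refine not_isCandidate_processed_card (g := g) (I := I) (X := univ) (L := L) o
      ⟨mem_univ _, disjoint_left.1 hJP ho.2, ?_, hlt⟩
    exact hI _ _ (insert_subset (mem_union_right _ ho.2) subset_union_left) hJ
  have h3 : ∑ o ∈ (O \ (P ∩ L)) \ J, marginal g (P ∩ L) o ≤
      ∑ o ∈ (O \ (P ∩ L)) \ J, max 0 (marginal g (P ∩ L) o) :=
    sum_le_sum fun _ _ => le_max_right _ _
  linarith

/-- Value of a subset `Q` of the set of processed elements of `N`, where `N` is disjoint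
from `L`. -/
lemma le_value_of_subset (hg : IsSubmodular g) {N Q : Finset α} (m : ℕ)
    (hQN : Q ⊆ processed g I X L m ∩ N) :
    g ∅ + ∑ i ∈ range m, ∑ e ∈ next g I X L (processed g I X L i),
        (if e ∈ N then marginal g (processed g I X L i ∩ (L ∪ N)) e else 0) -
      ∑ i ∈ range m, ∑ e ∈ next g I X L (processed g I X L i),
        (if e ∈ N ∧ e ∉ Q then marginal g (processed g I X L i ∩ L) e else 0) ≤ g Q := by
  -- `g Q` telescopes along the run. Elements of `Q` gain at least as much over `Q` as over `L ∪ N`;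
  -- each element of `N` outside `Q` costs at most its gain over `L`.
  have h := sum_next_marginal g I X L Q m
  rw [inter_eq_right.2 (hQN.trans inter_subset_left)] at h
  rw [add_sub_assoc, ← sum_sub_distrib, ← le_sub_iff_add_le', ← h]
  refine sum_le_sum fun i hi => ?_
  rw [← sum_sub_distrib]
  refine sum_le_sum fun e he => ?_
  have heP : e ∉ processed g I X L i := (mem_next.1 he).1.2.1
  have hQi : processed g I X L i ∩ Q ⊆ processed g I X L i ∩ (L ∪ N) :=
    inter_subset_inter_left ((hQN.trans inter_subset_right).trans subset_union_right)
  have hLi : processed g I X L i ∩ L ⊆ processed g I X L i ∩ (L ∪ N) :=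
    inter_subset_inter_left subset_union_left
  have hei : e ∉ processed g I X L i ∩ (L ∪ N) := fun h => heP (mem_inter.1 h).1
  by_cases heN : e ∈ N
  · by_cases heQ : e ∈ Q
    · simpa [heN, heQ] using hg.marginal_le hQi hei
    · simpa [heN, heQ] using hg.marginal_le hLi hei
  · have heQ : e ∉ Q := fun h => heN (mem_inter.1 (hQN h)).2
    simp [heN, heQ]

end Pathwise

/-! ### Averages over independent coins -/

section Expectation

variable {α : Type u} [Fintype α] [LinearOrder α]

/-- The elements whose coin shows heads: the sample. -/
def heads (c : α → Bool × Fin 50) : Finset α := univ.filter fun x => (c x).1 = true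

/-- The marked elements outside the sample. -/
def marks (c : α → Bool × Fin 50) : Finset α := univ.filter fun x => (c x).1 = false ∧ (c x).2 = 0

omit [LinearOrder α] in
lemma mem_heads {c : α → Bool × Fin 50} {x : α} : x ∈ heads c ↔ (c x).1 = true := by simp [heads]

omit [LinearOrder α] in
lemma mem_marks {c : α → Bool × Fin 50} {x : α} :
    x ∈ marks c ↔ (c x).1 = false ∧ (c x).2 = 0 := by simp [marks]

lemma mem_heads_update (c : α → Bool × Fin 50) (e : α) (a : Bool × Fin 50) :
    ∀ x ≠ e, x ∈ heads c ↔ x ∈ heads (Function.update c e a) := fun x hx => by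
  simp [mem_heads, hx]

lemma mem_marks_update (c : α → Bool × Fin 50) (e : α) (a : Bool × Fin 50) :
    ∀ x ≠ e, x ∈ marks c ↔ x ∈ marks (Function.update c e a) := fun x hx => by
  simp [mem_marks, hx]

omit [Fintype α] in
lemma inter_congr_of_notMem {P N N' : Finset α} {e : α} (he : e ∉ P)
    (h : ∀ x ≠ e, x ∈ N ↔ x ∈ N') : P ∩ N' = P ∩ N := by
  ext x
  simp only [mem_inter]
  refine and_congr_right fun hx => (h x ?_).symm
  rintro rfl
  exact he hx

/-- The elements processed in the first `i` steps, when the sample is given by the coins. -/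
noncomputable abbrev proc (g : Finset α → ℝ) (I : Finset α → Prop) (c : α → Bool × Fin 50)
    (i : ℕ) : Finset α := processed g I univ (heads c) i

/-- The set of the element processed in step `i`. -/
noncomputable abbrev step (g : Finset α → ℝ) (I : Finset α → Prop) (c : α → Bool × Fin 50)
    (i : ℕ) : Finset α := next g I univ (heads c) (proc g I c i)

/-- The gain from the element processed in step `i`. -/
noncomputable abbrev gain (g : Finset α → ℝ) (I : Finset α → Prop) (c : α → Bool × Fin 50)
    (i : ℕ) (e : α) : ℝ := marginal g (proc g I c i ∩ heads c) e

variable {g : Finset α → ℝ} {I : Finset α → Prop} {c : α → Bool × Fin 50} {e : α} {i : ℕ}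

lemma notMem_proc_of_mem_step (h : e ∈ step g I c i) : e ∉ proc g I c i := (mem_next.1 h).1.2.1

lemma proc_update (a : Bool × Fin 50) (he : e ∉ proc g I c i) :
    proc g I (Function.update c e a) i = proc g I c i :=
  processed_eq_of_notMem (mem_heads_update c e a) i he

lemma step_update (a : Bool × Fin 50) (he : e ∉ proc g I c i) :
    step g I (Function.update c e a) i = step g I c i := by
  rw [step, proc_update a he]
  exact next_eq_of_notMem (mem_heads_update c e a) he

lemma gain_update (a : Bool × Fin 50) (he : e ∉ proc g I c i) (v : α) :
    gain g I (Function.update c e a) i v = gain g I c i v := by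
  rw [gain, proc_update a he, inter_congr_of_notMem he (mem_heads_update c e a)]

/-- The coin of the element processed in step `i` is independent of the history. -/
lemma sum_step_mul (φ : (α → Bool × Fin 50) → α → ℝ) (r : Bool × Fin 50 → ℝ)
    (hφ : ∀ c e a, e ∉ proc g I c i → φ (Function.update c e a) e = φ c e) :
    100 * ∑ c, ∑ e ∈ step g I c i, φ c e * r (c e) =
      (∑ a, r a) * ∑ c, ∑ e ∈ step g I c i, φ c e := by
  have h1 : ∀ ψ : (α → Bool × Fin 50) → α → ℝ, ∑ c, ∑ e ∈ step g I c i, ψ c e =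
      ∑ e, ∑ c, if e ∈ step g I c i then ψ c e else 0 := fun ψ => by
    rw [sum_comm]
    refine sum_congr rfl fun c _ => ?_
    rw [sum_ite_mem, univ_inter]
  rw [h1, h1, mul_sum, mul_sum]
  refine sum_congr rfl fun e _ => ?_
  have h2 := card_mul_sum_mul_apply e (fun c => if e ∈ step g I c i then φ c e else 0) ?_ r
  · simp only [Fintype.card_prod, Fintype.card_bool, Fintype.card_fin, ite_mul, zero_mul] at h2
    norm_num at h2
    exact h2
  · intro c a
    by_cases he : e ∈ proc g I c i
    · have he' : e ∈ proc g I (Function.update c e a) i := by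
        -- Undoing the update shows that the coin of `e` does not affect whether `e` is processed in
        -- the first `i` steps.
        by_contra h
        have := proc_update (c e) h
        rw [Function.update_idem, Function.update_eq_self] at this
        exact h (this ▸ he)
      rw [if_neg fun h => notMem_proc_of_mem_step h he',
        if_neg fun h => notMem_proc_of_mem_step h he]
    · simp only [step_update a he, hφ c e a he]

lemma sum_coin_head : ∑ a : Bool × Fin 50, (if a.1 = true then (1 : ℝ) else 0) = 50 := by
  rw [Fintype.sum_prod_type]
  simp

lemma sum_coin_mark :
    ∑ a : Bool × Fin 50, (if a.1 = false ∧ a.2 = 0 then (1 : ℝ) else 0) = 1 := by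
  rw [Fintype.sum_prod_type]
  simp [filter_eq']

lemma sum_coin_head_or_mark : ∑ a : Bool × Fin 50,
    (if a.1 = true ∨ (a.1 = false ∧ a.2 = 0) then (1 : ℝ) else 0) = 51 := by
  rw [Fintype.sum_prod_type]
  simp [filter_eq']
  norm_num

/-- The expected value of the greedy solution in the sample. -/
lemma sum_value_chosen (g : Finset α → ℝ) (I : Finset α → Prop) :
    ∑ c, g (proc g I c (Fintype.card α) ∩ heads c) =
      Fintype.card (α → Bool × Fin 50) * g ∅ + 1 / 2 * ∑ c, totalGain g I (heads c) := by
  have h1 : ∀ i, ∑ c, ∑ e ∈ step g I c i, (if e ∈ heads c then gain g I c i e else 0) =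
      1 / 2 * ∑ c, ∑ e ∈ step g I c i, gain g I c i e := fun i => by
    have := sum_step_mul (g := g) (I := I) (i := i) (fun c e => gain g I c i e)
      (fun a => if a.1 = true then 1 else 0) fun c e a he => gain_update a he e
    rw [sum_coin_head] at this
    simp only [mem_heads, mul_boole] at this ⊢
    linarith
  have h2 : ∀ c : α → Bool × Fin 50, g (proc g I c (Fintype.card α) ∩ heads c) = g ∅ +
      ∑ i ∈ range (Fintype.card α),
        ∑ e ∈ step g I c i, (if e ∈ heads c then gain g I c i e else 0) := fun c => by
    rw [sum_next_marginal]
    ring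
  simp only [h2, sum_add_distrib, totalGain]
  rw [sum_comm, sum_congr rfl fun i _ => h1 i, ← mul_sum, sum_comm]
  simp

/-- The expected gain of the marked elements with respect to all sampled and marked elements that
were processed before. -/
lemma sum_gain_marks (g : Finset α → ℝ) (I : Finset α → Prop) :
    51 * ∑ c, ∑ i ∈ range (Fintype.card α), ∑ e ∈ step g I c i,
      (if e ∈ marks c then marginal g (proc g I c i ∩ (heads c ∪ marks c)) e else 0) =
    ∑ c, (g (proc g I c (Fintype.card α) ∩ (heads c ∪ marks c)) - g ∅) := by
  have hφ : ∀ i c e a, e ∉ proc g I c i →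
      marginal g (proc g I (Function.update c e a) i ∩
        (heads (Function.update c e a) ∪ marks (Function.update c e a))) e =
      marginal g (proc g I c i ∩ (heads c ∪ marks c)) e := fun i c e a he => by
    rw [proc_update a he, inter_congr_of_notMem (N := heads c ∪ marks c) he fun x hx => ?_]
    rw [mem_union, mem_union, mem_heads_update c e a x hx, mem_marks_update c e a x hx]
  have h1 : ∀ i, 51 * ∑ c, ∑ e ∈ step g I c i,
        (if e ∈ marks c then marginal g (proc g I c i ∩ (heads c ∪ marks c)) e else 0) =
      ∑ c, ∑ e ∈ step g I c i,
        (if e ∈ heads c ∪ marks c then marginal g (proc g I c i ∩ (heads c ∪ marks c)) e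
          else 0) := fun i => by
    have h1 := sum_step_mul (g := g) (I := I) (i := i)
      (fun c e => marginal g (proc g I c i ∩ (heads c ∪ marks c)) e)
      (fun a => if a.1 = false ∧ a.2 = 0 then 1 else 0) (hφ i)
    have h2 := sum_step_mul (g := g) (I := I) (i := i)
      (fun c e => marginal g (proc g I c i ∩ (heads c ∪ marks c)) e)
      (fun a => if a.1 = true ∨ (a.1 = false ∧ a.2 = 0) then 1 else 0) (hφ i)
    rw [sum_coin_mark] at h1
    rw [sum_coin_head_or_mark] at h2
    simp only [mem_union, mem_heads, mem_marks, mul_boole] at h1 h2 ⊢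
    linarith
  simp only [← sum_next_marginal]
  rw [sum_comm, mul_sum, sum_congr rfl fun i _ => h1 i, sum_comm]

lemma sum_mem_heads (e : α) : (∑ c : α → Bool × Fin 50, if e ∈ heads c then (1 : ℝ) else 0) =
    1 / 2 * Fintype.card (α → Bool × Fin 50) := by
  have := card_mul_sum_mul_apply (α := α) e (fun _ => (1 : ℝ)) (fun _ _ => rfl)
    (fun a : Bool × Fin 50 => if a.1 = true then 1 else 0)
  rw [sum_coin_head] at this
  simp only [Fintype.card_prod, Fintype.card_bool, Fintype.card_fin, one_mul, sum_const, card_univ,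
    nsmul_eq_mul, mul_one] at this
  simp only [mem_heads]
  push_cast at this
  linarith

omit [Fintype α] in
lemma IsSubmodular.union_left (hg : IsSubmodular g) (O : Finset α) :
    IsSubmodular fun S => g (O ∪ S) := by
  intro A B hAB e he
  simp only [union_insert]
  by_cases heO : e ∈ O
  · simp [heO]
  · exact hg (union_subset_union_right hAB) e (by simp [heO, he])

/-- Only sampled elements are chosen, so each is chosen with probability at most 1/2. -/
lemma sum_union_chosen (hg : IsSubmodular g) (h0 : ∀ S, 0 ≤ g S) (I : Finset α → Prop)
    (O : Finset α) :
    1 / 2 * Fintype.card (α → Bool × Fin 50) * g O ≤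
      ∑ c, g (O ∪ proc g I c (Fintype.card α) ∩ heads c) := by
  have := (hg.union_left O).sum_random_set (fun S => h0 _)
    (fun c : α → Bool × Fin 50 => proc g I c (Fintype.card α) ∩ heads c) (q := 1 / 2) (by norm_num)
    fun e => by
      rw [← sum_mem_heads e]
      refine sum_le_sum fun c _ => ?_
      by_cases h : e ∈ heads c
      · simp only [h, if_true]
        split_ifs <;> norm_num
      · simp [h]
  simp only [union_empty] at this
  linarith

/-- The expected total gain is at least a third of the optimum. -/
lemma le_sum_totalGain (hg : IsSubmodular g) (h0 : ∀ S, 0 ≤ g S)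
    (hI : ∀ A B, A ⊆ B → I B → I A)
    (hex : ∀ A J e, I (A ∪ J) → I (insert e A) →
      ∃ J' ⊆ J, (J \ J').card ≤ 1 ∧ I (insert e A ∪ J')) (O : Finset α) (hO : I O) :
    Fintype.card (α → Bool × Fin 50) * (g O - 2 * g ∅) ≤ 3 * ∑ c, totalGain g I (heads c) := by
  have h1 := sum_union_chosen hg h0 I O
  have h2 := sum_le_sum fun (c : α → Bool × Fin 50) (_ : c ∈ univ) =>
    union_chosen_le hg hI hex (heads c) O hO
  rw [sum_add_distrib, sum_value_chosen] at h2
  linarith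

/-- Given the sample, the processed set is fixed and each element is marked with probability at most
1/50, so adding the marked elements loses at most that fraction. -/
lemma proc_inter_union_marks (hg : IsSubmodular g) (h0 : ∀ S, 0 ≤ g S) (I : Finset α → Prop) :
    49 / 50 * ∑ c, g (proc g I c (Fintype.card α) ∩ heads c) ≤
      ∑ c, g (proc g I c (Fintype.card α) ∩ (heads c ∪ marks c)) := by
  have key : ∀ b : α → Bool,
      49 / 50 * ∑ k : α → Fin 50, g (proc g I (fun x => (b x, k x)) (Fintype.card α) ∩
        heads fun x => (b x, k x)) ≤
      ∑ k : α → Fin 50, g (proc g I (fun x => (b x, k x)) (Fintype.card α) ∩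
        ((heads fun x => (b x, k x)) ∪ marks fun x => (b x, k x))) := fun b => by
    set L : Finset α := univ.filter fun x => b x = true with hL
    have hh : ∀ k : α → Fin 50, (heads fun x => (b x, k x)) = L := fun k => rfl
    simp only [hh, proc, inter_union_distrib_left]
    set P := processed g I univ L (Fintype.card α)
    have := (hg.union_left (P ∩ L)).sum_random_set (fun S => h0 _)
      (fun k : α → Fin 50 => P ∩ marks fun x => (b x, k x)) (q := 1 / 50) (by norm_num)
      fun e => by
        have := card_mul_sum_mul_apply (α := α) e (fun _ => (1 : ℝ)) (fun _ _ => rfl)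
          (fun a : Fin 50 => if a = 0 then 1 else 0)
        simp only [Fintype.card_fin, one_mul, sum_const, card_univ, nsmul_eq_mul, mul_one,
          sum_ite_eq', mem_univ, if_true] at this
        have h2 : (∑ k : α → Fin 50,
            if e ∈ P ∩ marks fun x => (b x, k x) then (1 : ℝ) else 0) ≤
            ∑ k : α → Fin 50, if k e = 0 then (1 : ℝ) else 0 := by
          refine sum_le_sum fun k _ => ?_
          by_cases h : k e = 0
          · simp only [h, if_true]
            split_ifs <;> norm_num
          · simp [mem_marks, h]
        push_cast at this
        linarith
    simp only [union_empty] at this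
    rw [sum_const, card_univ, nsmul_eq_mul]
    linarith
  have hsplit : ∀ F : (α → Bool × Fin 50) → ℝ,
      ∑ c, F c = ∑ b : α → Bool, ∑ k : α → Fin 50, F fun x => (b x, k x) := fun F => by
    rw [← Fintype.sum_prod_type' (f := fun (b : α → Bool) (k : α → Fin 50) => F fun x => (b x, k x))]
    exact Fintype.sum_equiv (Equiv.arrowProdEquivProdArrow α (fun _ => Bool) (fun _ => Fin 50)) _ _
      fun c => rfl
  rw [hsplit, hsplit, mul_sum]
  exact sum_le_sum fun b _ => key b

end Expectation

/-! ### The loss from overfull members of the laminar family -/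

section Loss

variable {α : Type u} [Fintype α] [LinearOrder α]

/-- The gain from the first element of `A` that is processed, if this happens in the first `m`
steps. -/
noncomputable def firstGain (g : Finset α → ℝ) (I : Finset α → Prop) (A : Finset α)
    (c : α → Bool × Fin 50) (m : ℕ) : ℝ :=
  ∑ i ∈ range m, ∑ e ∈ step g I c i, if e ∈ A ∧ Disjoint (proc g I c i) A then gain g I c i e else 0

variable {g : Finset α → ℝ} {I : Finset α → Prop} {A : Finset α} {c : α → Bool × Fin 50}
  {e : α} {m : ℕ}

lemma gain_nonneg {i : ℕ} (h : e ∈ step g I c i) : 0 ≤ gain g I c i e :=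
  marginal_nonneg_of_mem_next h

lemma firstGain_succ : firstGain g I A c (m + 1) = firstGain g I A c m + ∑ e ∈ step g I c m,
    if e ∈ A ∧ Disjoint (proc g I c m) A then gain g I c m e else 0 := sum_range_succ _ _

lemma firstGain_mono : Monotone (firstGain g I A c) := by
  refine monotone_nat_of_le_succ fun m => ?_
  rw [firstGain_succ]
  refine le_add_of_nonneg_right (sum_nonneg fun e he => ?_)
  split_ifs
  · exact gain_nonneg he
  · exact le_rfl

lemma firstGain_nonneg : 0 ≤ firstGain g I A c m := by
  have := firstGain_mono (g := g) (I := I) (A := A) (c := c) (Nat.zero_le m)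
  simpa [firstGain] using this

lemma firstGain_update (a : Bool × Fin 50) (he : e ∉ proc g I c m) :
    firstGain g I A (Function.update c e a) m = firstGain g I A c m := by
  refine sum_congr rfl fun i hi => ?_
  have hei : e ∉ proc g I c i := fun h => he (processed_mono (mem_range.1 hi).le h)
  rw [step_update a hei, proc_update a hei]
  exact sum_congr rfl fun v _ => by rw [gain_update a hei]

lemma exists_first_step (h : ¬ Disjoint (proc g I c m) A) :
    ∃ i < m, ∃ v ∈ step g I c i, v ∈ A ∧ Disjoint (proc g I c i) A := by
  induction m with
  | zero => simp [proc, processed] at h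
  | succ m ih =>
    by_cases hm : Disjoint (proc g I c m) A
    · rw [proc, processed, disjoint_union_left, not_and] at h
      obtain ⟨v, hv, hvA⟩ := not_disjoint_iff.1 (h hm)
      exact ⟨m, m.lt_succ_self, v, hv, hvA, hm⟩
    · obtain ⟨i, hi, h⟩ := ih hm
      exact ⟨i, hi.trans m.lt_succ_self, h⟩

lemma gain_le_firstGain (hg : IsSubmodular g) (hI : ∀ A B, A ⊆ B → I B → I A)
    (he : e ∈ step g I c m) (heA : e ∈ A) : gain g I c m e ≤ firstGain g I A c (m + 1) := by
  obtain ⟨i, hi, v, hv, hvA⟩ : ∃ i < m + 1, ∃ v ∈ step g I c i, v ∈ A ∧ Disjoint (proc g I c i) A :=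
    exists_first_step (not_disjoint_iff.2 ⟨e, mem_union_right _ he, heA⟩)
  have h1 : gain g I c m e ≤ gain g I c i v :=
    marginal_anti hg hI (Nat.lt_succ_iff.1 hi) (mem_next.1 hv) (mem_next.1 he)
  have hnn : ∀ j, ∀ w ∈ step g I c j,
      0 ≤ if w ∈ A ∧ Disjoint (proc g I c j) A then gain g I c j w else 0 := fun j w hw => by
    split_ifs
    · exact gain_nonneg hw
    · exact le_rfl
  refine h1.trans ?_
  refine le_trans ?_ (single_le_sum (fun j _ => sum_nonneg (hnn j)) (mem_range.2 hi))
  refine le_trans ?_ (single_le_sum (hnn i) hv)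
  rw [if_pos hvA]

/-- Gains decrease along the run, so each counted element contributes at most the first gain in `A`.
-/
lemma sum_gain_le (hg : IsSubmodular g) (hI : ∀ A B, A ⊆ B → I B → I A) (N : Finset α) (m : ℕ) :
    ∑ i ∈ range m, ∑ e ∈ step g I c i, (if e ∈ N ∧ e ∈ A then gain g I c i e else 0) ≤
      firstGain g I A c m * (proc g I c m ∩ (N ∩ A)).card := by
  induction m with
  | zero => simp [firstGain]
  | succ m ih =>
    rw [sum_range_succ]
    have hmono : firstGain g I A c m ≤ firstGain g I A c (m + 1) := firstGain_mono m.le_succ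
    have ih' := ih.trans (mul_le_mul_of_nonneg_right hmono (Nat.cast_nonneg _))
    rcases processed_succ_cases g I univ (heads c) m with h | ⟨e, -, h1, h'⟩
    · rw [step, h.1, sum_empty, add_zero, proc, h.2]
      exact ih'
    · have he : e ∈ step g I c m := by rw [step, h1, mem_singleton]
      have heP := notMem_proc_of_mem_step he
      rw [step, h1, sum_singleton, proc, h']
      by_cases heN : e ∈ N ∧ e ∈ A
      · rw [if_pos heN, insert_inter_of_mem (mem_inter.2 heN),
          card_insert_of_notMem fun h => heP (mem_inter.1 h).1]
        have := gain_le_firstGain hg hI he heN.2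
        push_cast
        linarith
      · rw [if_neg heN, insert_inter_of_notMem fun h => heN (mem_inter.1 h), add_zero]
        exact ih'

/-- A martingale: every marked element of `A` multiplies it by `26`, every sampled element of `A`
divides it by `2`. -/
noncomputable def potential (g : Finset α → ℝ) (I : Finset α → Prop) (A : Finset α)
    (c : α → Bool × Fin 50) (m : ℕ) : ℝ :=
  26 ^ (proc g I c m ∩ (marks c ∩ A)).card * (1 / 2) ^ (proc g I c m ∩ (heads c ∩ A)).card

lemma potential_update (a : Bool × Fin 50) (he : e ∉ proc g I c m) :
    potential g I A (Function.update c e a) m = potential g I A c m := by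
  rw [potential, potential, proc_update a he,
    inter_congr_of_notMem (N := marks c ∩ A) (N' := marks (Function.update c e a) ∩ A) he
      fun x hx => by rw [mem_inter, mem_inter, mem_marks_update c e a x hx],
    inter_congr_of_notMem (N := heads c ∩ A) (N' := heads (Function.update c e a) ∩ A) he
      fun x hx => by rw [mem_inter, mem_inter, mem_heads_update c e a x hx]]

/-- The relative change of the potential due to a coin. -/
noncomputable def coinChange (a : Bool × Fin 50) : ℝ :=
  25 * (if a.1 = false ∧ a.2 = 0 then 1 else 0) - 1 / 2 * (if a.1 = true then 1 else 0)

/-- This fixes the factor 26: the probabilities 1/100 of a mark and 1/2 of sampling satisfy 25 ·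
1/100 = 1/2 · 1/2. -/
lemma sum_coinChange : ∑ a, coinChange a = 0 := by
  simp only [coinChange, sum_sub_distrib, ← mul_sum, sum_coin_head, sum_coin_mark]
  norm_num

lemma potential_insert (P : Finset α) (he : e ∉ P) (heA : e ∈ A) :
    (26 : ℝ) ^ (insert e P ∩ (marks c ∩ A)).card *
        (1 / 2) ^ (insert e P ∩ (heads c ∩ A)).card =
      26 ^ (P ∩ (marks c ∩ A)).card * (1 / 2) ^ (P ∩ (heads c ∩ A)).card *
        (1 + coinChange (c e)) := by
  have hP : ∀ S, e ∉ P ∩ S := fun S h => he (mem_inter.1 h).1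
  by_cases hh : (c e).1 = true
  · rw [insert_inter_of_notMem (s₂ := marks c ∩ A) (by simp [mem_marks, hh]),
      insert_inter_of_mem (by simp [mem_heads, hh, heA]), card_insert_of_notMem (hP _)]
    simp only [coinChange, hh]
    norm_num
    ring
  · rw [insert_inter_of_notMem (s₂ := heads c ∩ A) (by simp [mem_heads, hh])]
    rw [Bool.not_eq_true] at hh
    by_cases hm : (c e).2 = 0
    · rw [insert_inter_of_mem (by simp [mem_marks, hh, hm, heA]), card_insert_of_notMem (hP _)]
      simp only [coinChange, hh, hm]
      norm_num
      ring
    · rw [insert_inter_of_notMem (by simp [mem_marks, hm])]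
      simp [coinChange, hh, hm]

/-- The potential is 1 until an element of `A` is processed. The first gain is known before the coin
of that element and is constant afterwards, so it acts as a fixed factor in front of a martingale.
-/
lemma sum_firstGain_mul_potential (g : Finset α → ℝ) (I : Finset α → Prop) (A : Finset α) (m : ℕ) :
    ∑ c, firstGain g I A c m * (potential g I A c m - 1) = 0 := by
  induction m with
  | zero => simp [firstGain]
  | succ m ih =>
    set φ : (α → Bool × Fin 50) → α → ℝ := fun c e => if e ∈ A then
      (firstGain g I A c m + if Disjoint (proc g I c m) A then gain g I c m e else 0) *
        potential g I A c m else 0 with hφ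
    have h := sum_step_mul (g := g) (I := I) (i := m) φ coinChange fun c e a he => by
      simp only [hφ, firstGain_update a he, proc_update a he, gain_update a he,
        potential_update a he]
    rw [sum_coinChange, zero_mul, mul_eq_zero, or_iff_right (by norm_num)] at h
    suffices hstep : ∀ c, firstGain g I A c (m + 1) * (potential g I A c (m + 1) - 1) =
        firstGain g I A c m * (potential g I A c m - 1) +
          ∑ e ∈ step g I c m, φ c e * coinChange (c e) by
      rw [sum_congr rfl fun c _ => hstep c, sum_add_distrib, ih, h, add_zero]
    intro c
    rcases processed_succ_cases g I univ (heads c) m with h | ⟨e, -, h1, h'⟩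
    · rw [firstGain_succ, potential, show proc g I c (m + 1) = proc g I c m from h.2,
        show step g I c m = ∅ from h.1]
      simp [potential]
    · have he : e ∈ step g I c m := by rw [step, h1, mem_singleton]
      have heP := notMem_proc_of_mem_step he
      rw [firstGain_succ, potential, show proc g I c (m + 1) = insert e (proc g I c m) from h',
        show step g I c m = {e} from h1, sum_singleton, sum_singleton]
      by_cases heA : e ∈ A
      · rw [potential_insert _ heP heA, ← potential]
        simp only [hφ, heA, if_true, true_and]
        by_cases hd : Disjoint (proc g I c m) A
        · have hS : ∀ S, proc g I c m ∩ (S ∩ A) = ∅ := fun S =>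
            disjoint_iff_inter_eq_empty.1 (hd.mono_right inter_subset_right)
          have hpot : potential g I A c m = 1 := by
            rw [potential, hS, hS]
            simp
          rw [if_pos hd, hpot]
          ring
        · rw [if_neg hd]
          ring
      · have hS : ∀ S, e ∉ S ∩ A := fun S h => heA (mem_inter.1 h).2
        rw [insert_inter_of_notMem (hS _), insert_inter_of_notMem (hS _), ← potential]
        simp [hφ, heA]

/-- As `k + 1 ≤ x`, it suffices that 3 x 15^x ≤ 2 (26^x - 1). Equality holds at `x = 2`, where the
induction starts; `x = 1` is separate. -/
lemma lossFactor_bound {k x : ℕ} (h : k < x) :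
    (x : ℝ) ≤ 2 / (45 * 15 ^ k) * (26 ^ x - 1) := by
  have key : ∀ y : ℕ, 3 * ((y : ℝ) + 2) * 15 ^ (y + 2) ≤ 2 * (26 ^ (y + 2) - 1) := by
    intro y
    induction y with
    | zero => norm_num
    | succ y ih =>
      have h1 : (1 : ℝ) ≤ 15 ^ (y + 2) := one_le_pow₀ (by norm_num)
      have h2 : (1 : ℝ) ≤ 26 ^ (y + 2) := one_le_pow₀ (by norm_num)
      have h3 : (0 : ℝ) ≤ y * 15 ^ (y + 2) := by positivity
      rw [pow_succ _ (y + 2), pow_succ _ (y + 2)]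
      push_cast
      nlinarith
  have h15 : (15 : ℝ) ^ k ≤ 15 ^ (x - 1) := pow_le_pow_right₀ (by norm_num) (by omega)
  have hx : 3 * (x : ℝ) * 15 ^ x ≤ 2 * (26 ^ x - 1) := by
    obtain rfl | ⟨y, rfl⟩ : x = 1 ∨ ∃ y, x = y + 2 := by
      rcases x with _ | _ | y
      · omega
      · exact Or.inl rfl
      · exact Or.inr ⟨y, rfl⟩
    · norm_num
    · have := key y
      push_cast
      exact this
  rw [div_mul_eq_mul_div, le_div_iff₀ (by positivity)]
  have hx' : (15 : ℝ) ^ x = 15 ^ (x - 1) * 15 := by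
    rw [← pow_succ, Nat.sub_add_cancel (by omega)]
  have h3 := mul_le_mul_of_nonneg_left h15 (Nat.cast_nonneg (α := ℝ) x)
  rw [hx'] at hx
  linarith

/-- The full series is 2/45 · (15/13 - 15/14) = 1/273. -/
lemma sum_lossFactor_le (m : ℕ) :
    ∑ k ∈ range m, (2 : ℝ) / (45 * 15 ^ k) * (2 ^ k - 1) ≤ 1 / 273 := by
  have key : ∑ k ∈ range m, (2 : ℝ) / (45 * 15 ^ k) * (2 ^ k - 1) =
      1 / 273 - (2 / 39 * 2 ^ m - 1 / 21) / 15 ^ m := by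
    induction m with
    | zero => norm_num
    | succ m ih =>
      rw [sum_range_succ, ih]
      field_simp
      ring
  rw [key, sub_le_self_iff]
  have : (1 : ℝ) ≤ 2 ^ m := one_le_pow₀ (by norm_num)
  exact div_nonneg (by linarith) (by positivity)

/-- The expected gain of the marked elements of `A` is small on the event that there are more of
them than the capacity of `A`. -/
lemma sum_loss_le (hg : IsSubmodular g) (h0 : I ∅) (hI : ∀ A B, A ⊆ B → I B → I A) {k : ℕ}
    (hA : ∀ S, I S → (S ∩ A).card ≤ k) (m : ℕ) :
    ∑ c, (if k < (proc g I c m ∩ (marks c ∩ A)).card then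
        ∑ i ∈ range m, ∑ e ∈ step g I c i,
          (if e ∈ marks c ∧ e ∈ A then gain g I c i e else 0) else 0) ≤
      2 / (45 * 15 ^ k) * (2 ^ k - 1) * ∑ c, firstGain g I A c m := by
  have hc : (0 : ℝ) ≤ 2 / (45 * 15 ^ k) := by positivity
  have h1 : ∀ c : α → Bool × Fin 50, (if k < (proc g I c m ∩ (marks c ∩ A)).card then
        ∑ i ∈ range m, ∑ e ∈ step g I c i,
          (if e ∈ marks c ∧ e ∈ A then gain g I c i e else 0) else 0) ≤
      2 / (45 * 15 ^ k) * 2 ^ k * (firstGain g I A c m * (potential g I A c m - 1)) +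
        2 / (45 * 15 ^ k) * (2 ^ k - 1) * firstGain g I A c m := fun c => by
    have hfg := firstGain_nonneg (g := g) (I := I) (A := A) (c := c) (m := m)
    -- The sampled processed elements are independent, so at most `k` of them lie in `A` and the
    -- potential was halved at most `k` times.
    have hpot : (26 : ℝ) ^ (proc g I c m ∩ (marks c ∩ A)).card ≤ 2 ^ k * potential g I A c m := by
      have hcard : (proc g I c m ∩ (heads c ∩ A)).card ≤ k := by
        rw [← inter_assoc]
        exact hA _ (indep_processed h0 hI m)
      have h2 : (1 / 2 : ℝ) ^ k ≤ (1 / 2) ^ (proc g I c m ∩ (heads c ∩ A)).card :=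
        pow_le_pow_of_le_one (by norm_num) (by norm_num) hcard
      have h3 : (2 : ℝ) ^ k * (1 / 2) ^ k = 1 := by
        rw [← mul_pow]
        norm_num
      have h4 : (1 : ℝ) ≤ 2 ^ k * (1 / 2) ^ (proc g I c m ∩ (heads c ∩ A)).card := by
        refine h3.symm.le.trans ?_
        exact mul_le_mul_of_nonneg_left h2 (by positivity)
      rw [potential, mul_left_comm]
      exact le_mul_of_one_le_right (by positivity) h4
    have hrhs : 2 / (45 * 15 ^ k) * 2 ^ k * (firstGain g I A c m * (potential g I A c m - 1)) +
        2 / (45 * 15 ^ k) * (2 ^ k - 1) * firstGain g I A c m = firstGain g I A c m *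
        (2 / (45 * 15 ^ k) * (2 ^ k * potential g I A c m - 1)) := by ring
    rw [hrhs]
    have h5 : 2 / (45 * 15 ^ k) * ((26 : ℝ) ^ (proc g I c m ∩ (marks c ∩ A)).card - 1) ≤
        2 / (45 * 15 ^ k) * (2 ^ k * potential g I A c m - 1) :=
      mul_le_mul_of_nonneg_left (by linarith) hc
    split_ifs with hk
    · refine (sum_gain_le hg hI (marks c) m).trans (mul_le_mul_of_nonneg_left ?_ hfg)
      exact (lossFactor_bound hk).trans h5
    · refine mul_nonneg hfg (le_trans (mul_nonneg hc ?_) h5)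
      rw [sub_nonneg]
      exact one_le_pow₀ (by norm_num)
  refine (sum_le_sum fun c _ => h1 c).trans ?_
  rw [sum_add_distrib, ← mul_sum, sum_firstGain_mul_potential, mul_zero, zero_add, mul_sum]

/-- The members of capacity `k` of a family that are maximal among those. -/
def maxMembers (F : Finset (Finset α)) (κ : Finset α → ℕ) (k : ℕ) : Finset (Finset α) :=
  F.filter fun A => κ A = k ∧ ∀ B ∈ F, κ B = k → A ⊆ B → A = B

lemma exists_mem_maxMembers {F : Finset (Finset α)} {κ : Finset α → ℕ} (hA : A ∈ F) :
    ∃ B ∈ maxMembers F κ (κ A), A ⊆ B := by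
  obtain ⟨B, hAB, hB⟩ := (F.filter fun B => κ B = κ A).exists_le_maximal
    (mem_filter.2 ⟨hA, rfl⟩)
  have hBF := mem_filter.1 hB.1
  refine ⟨B, mem_filter.2 ⟨hBF.1, hBF.2, fun C hC hCk hBC => ?_⟩, hAB⟩
  have hC' : C ∈ F.filter fun B => κ B = κ A := mem_filter.2 ⟨hC, hCk⟩
  exact hB.eq_of_le hC' hBC

/-- Distinct maximal members of equal capacity are disjoint by laminarity, so each processed element
is counted at most once. -/
lemma sum_firstGain_le {F : Finset (Finset α)} {κ : Finset α → ℕ}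
    (hF : ∀ A ∈ F, ∀ B ∈ F, A ⊆ B ∨ B ⊆ A ∨ Disjoint A B) (k : ℕ) :
    ∑ A ∈ maxMembers F κ k, firstGain g I A c (Fintype.card α) ≤ totalGain g I (heads c) := by
  simp only [firstGain, totalGain]
  rw [sum_comm]
  refine sum_le_sum fun i _ => ?_
  rw [sum_comm]
  refine sum_le_sum fun e he => ?_
  by_cases h : ∃ A ∈ maxMembers F κ k, e ∈ A
  · obtain ⟨A, hA, heA⟩ := h
    rw [sum_eq_single_of_mem A hA fun B hB hBA => if_neg fun heB => hBA ?_]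
    · split_ifs
      · exact le_rfl
      · exact gain_nonneg he
    · have hA' := mem_filter.1 hA
      have hB' := mem_filter.1 hB
      rcases hF A hA'.1 B hB'.1 with h | h | h
      · exact (hA'.2.2 B hB'.1 hB'.2.1 h).symm
      · exact hB'.2.2 A hA'.1 hA'.2.1 h
      · exact absurd heB.1 (disjoint_left.1 h heA)
  · push Not at h
    rw [sum_eq_zero fun A hA => if_neg fun heA => h A hA heA.1]
    exact gain_nonneg he

open scoped Classical in
/-- The expected gain of the marked elements that belong to a member of the laminar family with more
marked elements than its capacity. -/
lemma sum_loss_laminar_le (hg : IsSubmodular g) {F : Finset (Finset α)} {κ : Finset α → ℕ}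
    (hF : ∀ A ∈ F, ∀ B ∈ F, A ⊆ B ∨ B ⊆ A ∨ Disjoint A B)
    (hIF : ∀ S, I S ↔ ∀ A ∈ F, (S ∩ A).card ≤ κ A) :
    ∑ c, ∑ i ∈ range (Fintype.card α), ∑ e ∈ step g I c i,
      (if e ∈ marks c ∧ ∃ A ∈ F, e ∈ A ∧
          κ A < (proc g I c (Fintype.card α) ∩ (marks c ∩ A)).card
        then gain g I c i e else 0) ≤
    1 / 273 * ∑ c, totalGain g I (heads c) := by
  set n := Fintype.card α with hn
  have h0 : I ∅ := (hIF _).2 fun A _ => by simp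
  have hI : ∀ A B, A ⊆ B → I B → I A := fun A B hAB hB => (hIF _).2 fun C hC =>
    (card_le_card (inter_subset_inter_right hAB)).trans ((hIF _).1 hB C hC)
  have hW : 0 ≤ ∑ c, totalGain g I (heads c) := sum_nonneg fun c _ => sum_nonneg fun i _ =>
    sum_nonneg fun e he => gain_nonneg he
  -- An overfull `A` lies in a maximal member of the same capacity, which is then overfull too. That
  -- capacity is below `n`, being smaller than a number of elements.
  have h1 : ∀ c : α → Bool × Fin 50, ∑ i ∈ range n, ∑ e ∈ step g I c i,
      (if e ∈ marks c ∧ ∃ A ∈ F, e ∈ A ∧ κ A < (proc g I c n ∩ (marks c ∩ A)).card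
        then gain g I c i e else 0) ≤
      ∑ k ∈ range n, ∑ A ∈ maxMembers F κ k,
        if k < (proc g I c n ∩ (marks c ∩ A)).card then ∑ i ∈ range n, ∑ e ∈ step g I c i,
          (if e ∈ marks c ∧ e ∈ A then gain g I c i e else 0) else 0 := fun c => by
    have hsw : ∀ (k : ℕ) A, (if k < (proc g I c n ∩ (marks c ∩ A)).card then
        ∑ i ∈ range n, ∑ e ∈ step g I c i,
          (if e ∈ marks c ∧ e ∈ A then gain g I c i e else 0) else 0) =
        ∑ i ∈ range n, ∑ e ∈ step g I c i, if k < (proc g I c n ∩ (marks c ∩ A)).card then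
          (if e ∈ marks c ∧ e ∈ A then gain g I c i e else 0) else 0 := fun k A => by
      split_ifs <;> simp
    simp only [hsw]
    rw [sum_congr rfl fun k _ => sum_comm, sum_comm]
    refine sum_le_sum fun i _ => ?_
    rw [sum_congr rfl fun k _ => sum_comm, sum_comm]
    refine sum_le_sum fun e he => ?_
    have hnn : ∀ (k : ℕ) A, 0 ≤ if k < (proc g I c n ∩ (marks c ∩ A)).card then
        (if e ∈ marks c ∧ e ∈ A then gain g I c i e else 0) else 0 := fun k A => by
      split_ifs
      exacts [gain_nonneg he, le_rfl, le_rfl]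
    split_ifs with h
    · obtain ⟨heN, A, hA, heA, hlt⟩ := h
      obtain ⟨B, hB, hAB⟩ := exists_mem_maxMembers (κ := κ) hA
      have hlt' : κ A < (proc g I c n ∩ (marks c ∩ B)).card :=
        hlt.trans_le (card_le_card (inter_subset_inter_left (inter_subset_inter_left hAB)))
      have hk : κ A ∈ range n := mem_range.2 (hlt.trans_le (card_le_univ _))
      refine le_trans ?_ (single_le_sum (fun k _ => sum_nonneg fun A _ => hnn k A) hk)
      refine le_trans ?_ (single_le_sum (fun B _ => hnn (κ A) B) hB)
      rw [if_pos hlt', if_pos ⟨heN, hAB heA⟩]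
    · exact sum_nonneg fun k _ => sum_nonneg fun A _ => hnn k A
  refine (sum_le_sum fun c _ => h1 c).trans ?_
  rw [sum_comm]
  calc _ ≤ ∑ k ∈ range n, (2 : ℝ) / (45 * 15 ^ k) * (2 ^ k - 1) *
        ∑ c, totalGain g I (heads c) := by
        refine sum_le_sum fun k _ => ?_
        rw [sum_comm]
        have hk : (0 : ℝ) ≤ 2 / (45 * 15 ^ k) * (2 ^ k - 1) :=
          mul_nonneg (by positivity) (sub_nonneg.2 (one_le_pow₀ (by norm_num)))
        refine (sum_le_sum fun A hA => sum_loss_le hg h0 hI (k := k) (A := A) ?_ n).trans ?_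
        · intro S hS
          have := mem_filter.1 hA
          exact ((hIF S).1 hS A this.1).trans this.2.1.le
        · rw [← mul_sum, sum_comm]
          exact mul_le_mul_of_nonneg_left (sum_le_sum fun c _ => sum_firstGain_le hF k) hk
    _ ≤ _ := by
        rw [← sum_mul]
        exact mul_le_mul_of_nonneg_right (sum_lossFactor_le n) hW

open scoped Classical in
/-- The main estimate: the expected value of any set of marked processed elements that contains those
which belong to no overfull member of the laminar family. -/
lemma sum_value_ge (hg : IsSubmodular g) (hg0 : ∀ S, 0 ≤ g S)
    {F : Finset (Finset α)} {κ : Finset α → ℕ}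
    (hF : ∀ A ∈ F, ∀ B ∈ F, A ⊆ B ∨ B ⊆ A ∨ Disjoint A B)
    (hIF : ∀ S, I S ↔ ∀ A ∈ F, (S ∩ A).card ≤ κ A)
    (hex : ∀ A J e, I (A ∪ J) → I (insert e A) →
      ∃ J' ⊆ J, (J \ J').card ≤ 1 ∧ I (insert e A ∪ J')) (O : Finset α) (hO : I O) :
    ∃ B : (α → Bool × Fin 50) → ℝ,
      (∀ c, ∀ Q ⊆ proc g I c (Fintype.card α) ∩ marks c,
        (∀ e ∈ proc g I c (Fintype.card α) ∩ marks c,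
          (∀ A ∈ F, e ∈ A → (proc g I c (Fintype.card α) ∩ (marks c ∩ A)).card ≤ κ A) → e ∈ Q) →
        B c ≤ g Q) ∧
      Fintype.card (α → Bool × Fin 50) * (1 / 585 * g O) ≤ ∑ c, B c := by
  set n := Fintype.card α with hn
  have hI : ∀ A B, A ⊆ B → I B → I A := fun A B hAB hB => (hIF _).2 fun C hC =>
    (card_le_card (inter_subset_inter_right hAB)).trans ((hIF _).1 hB C hC)
  -- The bound depends on the coins alone, whereas the accepted set also depends on the arrival
  -- order, which is correlated with the coins.
  refine ⟨fun c => g ∅ + ∑ i ∈ range n, ∑ e ∈ step g I c i,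
      (if e ∈ marks c then marginal g (proc g I c i ∩ (heads c ∪ marks c)) e else 0) -
    ∑ i ∈ range n, ∑ e ∈ step g I c i,
      (if e ∈ marks c ∧ ∃ A ∈ F, e ∈ A ∧ κ A < (proc g I c n ∩ (marks c ∩ A)).card
        then gain g I c i e else 0), fun c Q hQ hQ' => ?_, ?_⟩
  · refine le_trans (sub_le_sub_left ?_ _) (le_value_of_subset hg n hQ)
    refine sum_le_sum fun i hi => sum_le_sum fun e he => ?_
    by_cases h : e ∈ marks c ∧ e ∉ Q
    · rw [if_pos h, if_pos]
      refine ⟨h.1, ?_⟩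
      by_contra! hcon
      refine h.2 (hQ' e (mem_inter.2 ⟨?_, h.1⟩) hcon)
      exact processed_mono (Nat.succ_le_of_lt (mem_range.1 hi)) (mem_union_right _ he)
    · rw [if_neg h]
      split_ifs
      · exact gain_nonneg he
      · exact le_rfl
  -- The coefficient of the total gain is 49/5100 - 1/273; a third of it is about 1/505, which
  -- exceeds 1/585, and the terms in `g ∅` have a nonnegative balance.
  · have h1 := le_sum_totalGain hg hg0 hI hex O hO
    have h2 := sum_loss_laminar_le hg hF hIF
    have h3 := sum_gain_marks g I
    have h4 := proc_inter_union_marks hg hg0 I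
    have h5 := sum_value_chosen g I
    rw [← hn] at h2 h3 h4 h5
    rw [sum_sub_distrib] at h3
    rw [sum_sub_distrib, sum_add_distrib]
    simp only [sum_const, card_univ, nsmul_eq_mul] at h3 ⊢
    have hC : (0 : ℝ) ≤ Fintype.card (α → Bool × Fin 50) := Nat.cast_nonneg _
    have hCg := mul_nonneg hC (hg0 ∅)
    have hCO := mul_nonneg hC (hg0 O)
    rw [mul_sub] at h1
    linarith

end Loss

/-! ### The online acceptance rule -/

section Selection

variable {n : ℕ}

/-- The marked elements that the greedy algorithm on the sample and this element processes. -/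
noncomputable def candidates (g : Finset (Fin n) → ℝ) (I : Finset (Fin n) → Prop)
    (c : Fin n → Bool × Fin 50) : Finset (Fin n) :=
  univ.filter fun x => x ∈ marks c ∧ x ∈ processed g I (insert x (heads c)) (heads c) n

open scoped Classical in
/-- The candidates that do not depend on candidates with smaller arrival time `τ`. -/
noncomputable def selected (g : Finset (Fin n) → ℝ) (I : Finset (Fin n) → Prop)
    (c : Fin n → Bool × Fin 50) (τ : Fin n → Fin n) : Finset (Fin n) :=
  univ.filter fun x => x ∈ candidates g I c ∧
    ∀ J ⊆ (candidates g I c).filter (fun y => τ y < τ x), I J → I (insert x J)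

variable {g : Finset (Fin n) → ℝ} {I : Finset (Fin n) → Prop} {c : Fin n → Bool × Fin 50}
  {τ : Fin n → Fin n}

lemma mem_candidates {x : Fin n} : x ∈ candidates g I c ↔
    x ∈ marks c ∧ x ∈ processed g I (insert x (heads c)) (heads c) n := by simp [candidates]

lemma mem_selected {x : Fin n} : x ∈ selected g I c τ ↔ x ∈ candidates g I c ∧
    ∀ J ⊆ (candidates g I c).filter (fun y => τ y < τ x), I J → I (insert x J) := by
  simp [selected]

lemma candidates_eq : candidates g I c = proc g I c (Fintype.card (Fin n)) ∩ marks c := by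
  ext x
  have h := processed_univ_inter (g := g) (I := I) (subset_insert x (heads c))
  rw [mem_candidates, mem_inter, and_comm]
  refine and_congr_left fun _ => ?_
  rw [Fintype.card_fin] at h ⊢
  rw [← h]
  simp

/-- Induction over arrival times: the previously accepted elements are one of the sets `J` that an
accepted candidate must extend. -/
lemma indep_selected (h0 : I ∅) (hτ : Function.Injective τ) : I (selected g I c τ) := by
  have key : ∀ m : ℕ, I ((selected g I c τ).filter fun x => (τ x : ℕ) < m) := by
    intro m
    induction m with
    | zero => simpa using h0
    | succ m ih =>
      by_cases hx : ∃ x ∈ selected g I c τ, (τ x : ℕ) = m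
      · obtain ⟨x, hx, hxm⟩ := hx
        have heq : ((selected g I c τ).filter fun x => (τ x : ℕ) < m + 1) =
            insert x ((selected g I c τ).filter fun x => (τ x : ℕ) < m) := by
          ext y
          simp only [mem_filter, mem_insert]
          constructor
          · rintro ⟨hy, hym⟩
            rcases Nat.lt_succ_iff_lt_or_eq.1 hym with h | h
            · exact Or.inr ⟨hy, h⟩
            · exact Or.inl (hτ (Fin.ext (h.trans hxm.symm)))
          · rintro (rfl | h)
            · exact ⟨hx, by omega⟩
            · exact ⟨h.1, by omega⟩
        rw [heq]
        refine (mem_selected.1 hx).2 _ (fun y hy => ?_) ih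
        rw [mem_filter] at hy ⊢
        exact ⟨(mem_selected.1 hy.1).1, Fin.lt_def.2 (hxm ▸ hy.2)⟩
      · push Not at hx
        have heq : ((selected g I c τ).filter fun x => (τ x : ℕ) < m + 1) =
            (selected g I c τ).filter fun x => (τ x : ℕ) < m := by
          refine filter_congr fun y hy => ?_
          have := hx y hy
          omega
        rw [heq]
        exact ih
  have := key n
  rwa [filter_true_of_mem fun x _ => (τ x).isLt] at this

/-- A candidate that belongs to no overfull set is selected. -/
lemma mem_selected_of_card_le {F : Finset (Finset (Fin n))} {κ : Finset (Fin n) → ℕ}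
    (hIF : ∀ S, I S ↔ ∀ A ∈ F, (S ∩ A).card ≤ κ A) {x : Fin n} (hx : x ∈ candidates g I c)
    (h : ∀ A ∈ F, x ∈ A → (candidates g I c ∩ A).card ≤ κ A) : x ∈ selected g I c τ := by
  refine mem_selected.2 ⟨hx, fun J hJ hJI => (hIF _).2 fun A hA => ?_⟩
  by_cases hxA : x ∈ A
  · refine (card_le_card (inter_subset_inter_right ?_)).trans (h A hA hxA)
    exact insert_subset hx (hJ.trans (filter_subset _ _))
  · rw [insert_inter_of_notMem hxA]
    exact (hIF _).1 hJI A hA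

/-- The decision about `x` depends only on the sets of elements that arrived before. -/
lemma mem_selected_congr {g' : Finset (Fin n) → ℝ} {I' : Finset (Fin n) → Prop} {x : Fin n}
    (hg : ∀ S, (∀ y ∈ S, τ y ≤ τ x) → g S = g' S)
    (hI : ∀ S, (∀ y ∈ S, τ y ≤ τ x) → (I S ↔ I' S))
    (hc : ∀ y ∈ heads c, ∀ z ∈ marks c, τ y ≤ τ z) :
    x ∈ selected g I c τ ↔ x ∈ selected g' I' c τ := by
  have hcand : ∀ y, τ y ≤ τ x → (y ∈ candidates g I c ↔ y ∈ candidates g' I' c) := by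
    intro y hy
    rw [mem_candidates, mem_candidates]
    refine and_congr_right fun hym => ?_
    have hX : ∀ S ⊆ insert y (heads c), ∀ z ∈ S, τ z ≤ τ x := fun S hS z hz => by
      rcases mem_insert.1 (hS hz) with rfl | hz
      · exact hy
      · exact (hc z hz y hym).trans hy
    rw [processed_congr (fun S hS => hg S (hX S hS)) fun S hS => hI S (hX S hS)]
  have hfilter : (candidates g I c).filter (fun y => τ y < τ x) =
      (candidates g' I' c).filter (fun y => τ y < τ x) := by
    ext y
    rw [mem_filter, mem_filter]
    exact and_congr_left fun hy => hcand y hy.le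
  rw [mem_selected, mem_selected, hcand x le_rfl, hfilter]
  refine and_congr_right fun hx => forall_congr' fun J => imp_congr_right fun hJ => ?_
  have hJ' : ∀ y ∈ J, τ y ≤ τ x := fun y hy => (mem_filter.1 (hJ hy)).2.le
  rw [hI J hJ', hI (insert x J) fun y hy => ?_]
  rcases mem_insert.1 hy with rfl | hy
  · exact le_rfl
  · exact hJ' y hy

end Selection

/-! ### The algorithm in the oracle model -/

section Algorithm

/-- The coins of the labels: the sample consists of the first elements, as many as `b` has values
`true`; label `x` arrives at time `σ⁻¹ x`, and `k` marks the times. -/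
def seedCoins {n : ℕ} (σ : Equiv.Perm (Fin n)) (b : Fin n → Bool) (k : Fin n → Fin 50) :
    Fin n → Bool × Fin 50 :=
  fun x => (decide ((σ.symm x : ℕ) < (univ.filter fun i => b i = true).card), k (σ.symm x))

/-- The times up to `t` whose labels belong to `S`. -/
def arrivedWithLabel {n : ℕ} (σ : Equiv.Perm (Fin n)) (t : Fin n) (S : Finset (Fin n)) :
    Finset (Fin (t + 1)) :=
  univ.filter fun s => σ (Fin.castLE (Nat.succ_le_of_lt t.isLt) s) ∈ S

open scoped Classical in
/-- The algorithm: the elements get labels by a random permutation `σ`, which serve to break ties. The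
first elements (binomially many) are rejected and form the sample. An element that arrives later is a
candidate if it is marked (with probability `1 / 50`) and the greedy algorithm processes it together
with the sample. A candidate is accepted if it does not depend on the earlier candidates. -/
noncomputable def sampleGreedy : OnlineAlgorithm where
  Seed n := Equiv.Perm (Fin n) × (Fin n → Bool) × (Fin n → Fin 50)
  dist _ := PMF.uniformOfFintype _
  -- Sets with labels that have not yet arrived are truncated; by `mem_selected_congr` this cannot
  -- affect the decision.
  accept _ ω t value indep := decide (ω.1 t ∈ selected
    (fun S => value (arrivedWithLabel ω.1 t S)) (fun S => indep (arrivedWithLabel ω.1 t S))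
    (seedCoins ω.1 ω.2.1 ω.2.2) ω.1.symm)

lemma seedCoins_heads_before_marks {n : ℕ} (σ : Equiv.Perm (Fin n)) (b : Fin n → Bool)
    (k : Fin n → Fin 50) : ∀ y ∈ heads (seedCoins σ b k), ∀ z ∈ marks (seedCoins σ b k),
      σ.symm y ≤ σ.symm z := by
  intro y hy z hz
  rw [mem_heads] at hy
  rw [mem_marks] at hz
  simp only [seedCoins, decide_eq_true_eq, decide_eq_false_iff_not] at hy hz
  exact Fin.le_def.2 (by omega)

variable {E : Type u} [Fintype E]

lemma map_arrivedWithLabel (π : Fin (Fintype.card E) ≃ E) (σ : Equiv.Perm (Fin (Fintype.card E)))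
    (t : Fin (Fintype.card E)) (S : Finset (Fin (Fintype.card E))) (hS : ∀ y ∈ S, σ.symm y ≤ t) :
    (arrivedWithLabel σ t S).map (arrived π t) = S.map (σ.symm.trans π).toEmbedding := by
  ext e
  simp only [mem_map, arrivedWithLabel, mem_filter, mem_univ, true_and, arrived]
  constructor
  · rintro ⟨s, hs, rfl⟩
    exact ⟨_, hs, by simp⟩
  · rintro ⟨y, hy, rfl⟩
    refine ⟨⟨σ.symm y, Nat.lt_succ_of_le (Fin.le_def.1 (hS y hy))⟩, ?_, ?_⟩
    · simpa [Fin.castLE] using hy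
    · simp [Fin.castLE]

/-- The order `π` enters only through the labelling `σ.symm.trans π`. For a fixed seed this
labelling is uniform when `π` is, so labelling and seed can be averaged separately. -/
lemma sampleGreedy_output (M : Matroid E) (f : Finset E → ℝ) (π : Fin (Fintype.card E) ≃ E)
    (σ : Equiv.Perm (Fin (Fintype.card E))) (b : Fin (Fintype.card E) → Bool)
    (k : Fin (Fintype.card E) → Fin 50) :
    sampleGreedy.output M f π (σ, b, k) =
      (selected (fun S => f (S.map (σ.symm.trans π).toEmbedding))
        (fun S => M.Indep (S.map (σ.symm.trans π).toEmbedding : Finset E))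
        (seedCoins σ b k) σ.symm).map (σ.symm.trans π).toEmbedding := by
  have key : ∀ t, σ t ∈ selected
      (fun S => f ((arrivedWithLabel σ t S).map (arrived π t)))
      (fun S => M.Indep ((arrivedWithLabel σ t S).map (arrived π t) : Finset E))
      (seedCoins σ b k) σ.symm ↔ σ t ∈ selected
      (fun S => f (S.map (σ.symm.trans π).toEmbedding))
      (fun S => M.Indep (S.map (σ.symm.trans π).toEmbedding : Finset E))
      (seedCoins σ b k) σ.symm := fun t => by
    refine mem_selected_congr (fun S hS => ?_) (fun S hS => ?_)
      (seedCoins_heads_before_marks σ b k)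
    all_goals
      rw [Equiv.symm_apply_apply] at hS
      rw [map_arrivedWithLabel π σ t S hS]
  ext e
  simp only [OnlineAlgorithm.output, sampleGreedy, mem_map, mem_filter, mem_univ, true_and,
    decide_eq_true_eq]
  constructor
  · rintro ⟨t, ht, rfl⟩
    exact ⟨σ t, (key t).1 ht, by simp⟩
  · rintro ⟨y, hy, rfl⟩
    refine ⟨σ.symm y, (key _).2 ?_, by simp⟩
    rwa [Equiv.apply_symm_apply]

/-- The coins of the labels are uniformly distributed. -/
lemma sum_seedCoins {n : ℕ} (B : (Fin n → Bool × Fin 50) → ℝ) :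
    ∑ ω : Equiv.Perm (Fin n) × (Fin n → Bool) × (Fin n → Fin 50),
      B (seedCoins ω.1 ω.2.1 ω.2.2) = n.factorial * ∑ c, B c := by
  -- `ρ` moves the heads of `b` to an initial segment of times; replacing `σ` by `σ * ρ⁻¹` turns the
  -- initial-segment sample into independent coins.
  have hperm : ∀ b : Fin n → Bool, ∃ ρ : Equiv.Perm (Fin n), ∀ i,
      ((ρ i : ℕ) < (univ.filter fun i => b i = true).card ↔ b i = true) := fun b => by
    have hcard : Fintype.card {i // b i = true} =
        Fintype.card {i : Fin n // (i : ℕ) < (univ.filter fun i => b i = true).card} := by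
      rw [Fintype.card_subtype, Fintype.card_subtype, Fin.card_filter_val_lt]
      exact (min_eq_right ((card_le_univ _).trans (Fintype.card_fin n).le)).symm
    obtain ⟨e⟩ := Fintype.card_eq.1 hcard
    refine ⟨e.extendSubtype, fun i => ⟨fun h => ?_, fun h => e.extendSubtype_mem i h⟩⟩
    by_contra hi
    exact e.extendSubtype_not_mem i hi h
  have h1 : ∀ b : Fin n → Bool, ∑ σ : Equiv.Perm (Fin n), ∑ k : Fin n → Fin 50,
      B (seedCoins σ b k) = ∑ σ : Equiv.Perm (Fin n), ∑ k : Fin n → Fin 50,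
        B fun x => (b (σ.symm x), k x) := fun b => by
    obtain ⟨ρ, hρ⟩ := hperm b
    refine (Fintype.sum_equiv (Equiv.mulRight ρ⁻¹) _ _ fun σ => ?_).symm
    refine Fintype.sum_equiv (Equiv.arrowCongr ((Equiv.mulRight ρ⁻¹) σ).symm (Equiv.refl _)) _ _
      fun k => ?_
    congr 1
    ext x
    · have hb := hρ (σ.symm x)
      have : (((Equiv.mulRight ρ⁻¹) σ).symm x) = ρ (σ.symm x) := rfl
      simp only [seedCoins, this, hb, Bool.decide_eq_true]
    · have h2 : σ (ρ.symm (ρ (σ.symm x))) = x := by simp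
      exact congrArg (fun y => (k y : ℕ)) h2.symm
  have h2 : ∀ σ : Equiv.Perm (Fin n), ∑ b : Fin n → Bool, ∑ k : Fin n → Fin 50,
      B (fun x => (b (σ.symm x), k x)) = ∑ c, B c := fun σ => by
    have : ∑ c, B c = ∑ b : Fin n → Bool, ∑ k : Fin n → Fin 50, B fun x => (b x, k x) := by
      rw [← Fintype.sum_prod_type'
        (f := fun (b : Fin n → Bool) (k : Fin n → Fin 50) => B fun x => (b x, k x))]
      exact Fintype.sum_equiv
        (Equiv.arrowProdEquivProdArrow (Fin n) (fun _ => Bool) (fun _ => Fin 50)) _ _ fun c => rfl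
    rw [this]
    exact Fintype.sum_equiv (Equiv.arrowCongr σ (Equiv.refl _)) _ _ fun b => rfl
  simp only [Fintype.sum_prod_type]
  rw [sum_comm, sum_congr rfl fun b _ => h1 b, sum_comm, sum_congr rfl fun σ _ => h2 σ]
  simp [Fintype.card_perm]

end Algorithm

/-! ### Matroid exchange and transfer to labels -/

section Laminar

variable {E : Type u} {n : ℕ}

/-- Adding an element to an independent set `A` makes it necessary to remove at most one element of
an independent set `A ∪ J`. -/
lemma exists_exchange (M : Matroid E) (hM : M.E = Set.univ) (ℓ : Fin n ≃ E) (A J : Finset (Fin n))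
    (e : Fin n) (hAJ : M.Indep ((A ∪ J).map ℓ.toEmbedding : Finset E))
    (he : M.Indep ((insert e A).map ℓ.toEmbedding : Finset E)) :
    ∃ J' ⊆ J, (J \ J').card ≤ 1 ∧ M.Indep ((insert e A ∪ J').map ℓ.toEmbedding : Finset E) := by
  classical
  obtain ⟨B, hB, hsub⟩ := he.subset_isBasis_of_subset
    (X := ((insert e (A ∪ J)).map ℓ.toEmbedding : Finset E))
    (by
      rw [coe_subset, map_subset_map]
      exact insert_subset_insert _ subset_union_left) (by simp [hM])
  set B' : Finset (Fin n) := univ.filter fun x => ℓ x ∈ B with hB'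
  have hBB' : ((B'.map ℓ.toEmbedding : Finset E) : Set E) = B := by
    ext x
    simp [hB']
  rw [← hBB'] at hB hsub
  rw [coe_subset, map_subset_map] at hsub
  have hBX : B' ⊆ insert e (A ∪ J) := by
    have := hB.subset
    rwa [coe_subset, map_subset_map] at this
  have hcard : (A ∪ J).card ≤ B'.card := by
    have h1 := hAJ.encard_le_eRk_of_subset
      (X := ((insert e (A ∪ J)).map ℓ.toEmbedding : Finset E)) (by
        rw [coe_subset, map_subset_map]
        exact subset_insert _ _)
    rw [← hB.encard_eq_eRk, Set.encard_coe_eq_coe_finsetCard, Set.encard_coe_eq_coe_finsetCard,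
      card_map, card_map] at h1
    exact_mod_cast h1
  -- The basis has at least as many elements as `A ∪ J`, so it misses at most one element of `insert
  -- e (A ∪ J)`.
  refine ⟨J ∩ B', inter_subset_left, ?_, hB.indep.subset ?_⟩
  · have h1 : B' ⊆ insert e (A ∪ J) \ (J \ (J ∩ B')) := by
      intro x hx
      have := hBX hx
      simp only [mem_sdiff, mem_inter]
      tauto
    have h2 : J \ (J ∩ B') ⊆ insert e (A ∪ J) :=
      sdiff_subset.trans (subset_union_right.trans (subset_insert _ _))
    have h3 := card_le_card h1
    rw [card_sdiff_of_subset h2] at h3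
    have h4 := card_le_card h2
    have h5 := card_insert_le e (A ∪ J)
    omega
  · rw [coe_subset, map_subset_map]
    exact union_subset hsub inter_subset_right

/-- A laminar matroid in terms of finite sets of labels. -/
lemma IsLaminarMatroid.exists_finset {M : Matroid E} (h : IsLaminarMatroid M) (hM : M.E = Set.univ)
    (ℓ : Fin n ≃ E) : ∃ (F : Finset (Finset (Fin n))) (κ : Finset (Fin n) → ℕ),
      (∀ A ∈ F, ∀ B ∈ F, A ⊆ B ∨ B ⊆ A ∨ Disjoint A B) ∧
      ∀ S : Finset (Fin n), M.Indep (S.map ℓ.toEmbedding : Finset E) ↔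
        ∀ A ∈ F, (S ∩ A).card ≤ κ A := by
  classical
  obtain ⟨F, c, -, hF, hind⟩ := h
  refine ⟨univ.filter fun A => ((A.map ℓ.toEmbedding : Finset E) : Set E) ∈ F,
    fun A => c ((A.map ℓ.toEmbedding : Finset E) : Set E), fun A hA B hB => ?_, fun S => ?_⟩
  · simp only [mem_filter, mem_univ, true_and] at hA hB
    have := hF _ hA _ hB
    rwa [coe_subset, coe_subset, map_subset_map, map_subset_map, disjoint_coe, disjoint_map]
      at this
  · have hcard : ∀ A : Finset (Fin n), (((S.map ℓ.toEmbedding : Finset E) : Set E) ∩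
        ((A.map ℓ.toEmbedding : Finset E) : Set E)).encard = (S ∩ A).card := fun A => by
      rw [← coe_inter, ← map_inter, Set.encard_coe_eq_coe_finsetCard, card_map]
    rw [hind _ (by simp [hM])]
    constructor
    · intro h A hA
      have := h _ (mem_filter.1 hA).2
      rw [hcard] at this
      exact_mod_cast this
    · intro h A hA
      have hA' : (((univ.filter fun x => ℓ x ∈ A).map ℓ.toEmbedding : Finset E) : Set E) = A := by
        ext x
        simp
      have := h (univ.filter fun x => ℓ x ∈ A) (mem_filter.2 ⟨mem_univ _, by rwa [hA']⟩)
      rw [← hA', hcard]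
      exact_mod_cast this

end Laminar

/-! ### Assembling the competitive ratio -/

section Competitive

/-- The algorithm is `585`-competitive for laminar matroids. -/
theorem sampleGreedy_isCompetitiveOn :
    OnlineAlgorithm.IsCompetitiveOn.{u} sampleGreedy 585 IsLaminarMatroid := by
  refine fun E _ _ M f hM hlam hf0 hf => ⟨?_, ?_⟩
  · rintro π ⟨σ, b, k⟩
    rw [sampleGreedy_output]
    exact indep_selected (I := fun S => M.Indep (S.map (σ.symm.trans π).toEmbedding : Finset E))
      (by simp) σ.symm.injective
  · set n := Fintype.card E
    obtain ⟨O, hO, hopt⟩ : ∃ O : Finset E, M.Indep (O : Set E) ∧ optValue M f = f O := by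
      classical
      obtain ⟨O, hO, h⟩ := exists_mem_eq_sup'
        (s := univ.filter fun S : Finset E => M.Indep (S : Set E)) ⟨∅, by simp⟩ f
      exact ⟨O, (mem_filter.1 hO).2, by rw [optValue]; convert h⟩
    rw [hopt]
    -- The estimate holds for every fixed labelling: the seed alone makes the coins of the labels
    -- uniform.
    have hℓ : ∀ ℓ : Fin n ≃ E,
        n.factorial * (Fintype.card (Fin n → Bool × Fin 50) * (1 / 585 * f O)) ≤
        ∑ ω : Equiv.Perm (Fin n) × (Fin n → Bool) × (Fin n → Fin 50),
          f ((selected (fun S => f (S.map ℓ.toEmbedding))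
            (fun S => M.Indep (S.map ℓ.toEmbedding : Finset E))
            (seedCoins ω.1 ω.2.1 ω.2.2) ω.1.symm).map ℓ.toEmbedding) := fun ℓ => by
      obtain ⟨F, κ, hF, hIF⟩ := hlam.exists_finset hM ℓ
      have hOℓ : (O.map ℓ.symm.toEmbedding).map ℓ.toEmbedding = O := by
        ext x
        simp
      have hsub : IsSubmodular fun S : Finset (Fin n) => f (S.map ℓ.toEmbedding) := by
        intro A B hAB e he
        simp only [map_insert]
        refine hf (map_subset_map.2 hAB) _ ?_
        simpa using he
      obtain ⟨B, hB, hBsum⟩ := sum_value_ge hsub (fun S => hf0 _) hF hIF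
        (exists_exchange M hM ℓ) (O.map ℓ.symm.toEmbedding) (by rwa [hOℓ])
      rw [hOℓ] at hBsum
      refine (mul_le_mul_of_nonneg_left hBsum (Nat.cast_nonneg _)).trans ?_
      rw [← sum_seedCoins]
      refine sum_le_sum fun ω _ => hB _ _ ?_ ?_
      · rw [← candidates_eq]
        exact fun x hx => (mem_selected.1 hx).1
      · rw [← candidates_eq]
        intro x hx h
        refine mem_selected_of_card_le hIF hx fun A hA hxA => ?_
        have := h A hA hxA
        rwa [candidates_eq, inter_assoc]
    have hsum : ∑ π : Fin n ≃ E, ∑ ω : sampleGreedy.Seed n, f (sampleGreedy.output M f π ω) =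
        ∑ ℓ : Fin n ≃ E, ∑ ω : Equiv.Perm (Fin n) × (Fin n → Bool) × (Fin n → Fin 50),
          f ((selected (fun S => f (S.map ℓ.toEmbedding))
            (fun S => M.Indep (S.map ℓ.toEmbedding : Finset E))
            (seedCoins ω.1 ω.2.1 ω.2.2) ω.1.symm).map ℓ.toEmbedding) := by
      rw [sum_comm, sum_comm (γ := Fin n ≃ E)]
      refine sum_congr rfl fun ω _ => ?_
      refine Fintype.sum_equiv (Equiv.equivCongr ω.1 (Equiv.refl E)) _ _ fun π => ?_
      exact congrArg f (sampleGreedy_output M f π ω.1 ω.2.1 ω.2.2)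
    have hdist : ∀ ω : sampleGreedy.Seed n, (sampleGreedy.dist n ω).toReal =
        ((n.factorial : ℝ) * Fintype.card (Fin n → Bool × Fin 50))⁻¹ := fun ω => by
      have hcard : Fintype.card (Equiv.Perm (Fin n) × (Fin n → Bool) × (Fin n → Fin 50)) =
          n.factorial * Fintype.card (Fin n → Bool × Fin 50) := by
        rw [Fintype.card_prod, Fintype.card_perm, Fintype.card_fin, ← Fintype.card_congr
          (Equiv.arrowProdEquivProdArrow (Fin n) (fun _ => Bool) (fun _ => Fin 50))]
      have : sampleGreedy.dist n ω = ((Fintype.card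
          (Equiv.Perm (Fin n) × (Fin n → Bool) × (Fin n → Fin 50)) : ENNReal))⁻¹ :=
        PMF.uniformOfFintype_apply
          (α := Equiv.Perm (Fin n) × (Fin n → Bool) × (Fin n → Fin 50)) ω
      rw [this, hcard]
      simp
    have hn0 : (0 : ℝ) < n.factorial := by exact_mod_cast n.factorial_pos
    have hC0 : (0 : ℝ) < Fintype.card (Fin n → Bool × Fin 50) := by
      exact_mod_cast Fintype.card_pos
    rw [OnlineAlgorithm.expectedValue]
    change _ ≤ (∑ π : Fin n ≃ E, ∑ ω : sampleGreedy.Seed n,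
      (sampleGreedy.dist n ω).toReal * f (sampleGreedy.output M f π ω)) / (n.factorial : ℝ)
    rw [le_div_iff₀ hn0]
    simp only [hdist, ← mul_sum]
    rw [hsum, ← div_eq_inv_mul, le_div_iff₀ (by positivity)]
    have hfin := sum_le_sum fun (ℓ : Fin n ≃ E) (_ : ℓ ∈ univ) => hℓ ℓ
    rw [sum_const, card_univ, Fintype.card_equiv (Fintype.equivFin E).symm, Fintype.card_fin,
      nsmul_eq_mul] at hfin
    refine le_trans (le_of_eq ?_) hfin
    ring

end Competitive

end SMSP

theorem mainTheorem9 :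
    ∃ A : SMSP.OnlineAlgorithm,
      SMSP.OnlineAlgorithm.IsCompetitiveOn.{u} A 585 SMSP.IsLaminarMatroid := by
  exact ⟨SMSP.sampleGreedy, SMSP.sampleGreedy_isCompetitiveOn⟩
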